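/- For each $n\ge 1$ let $p_n\in[0,1]$ and let $A=A_n=(a_{ij})_{1\le i,j\le n}$ be a random real symmetric matrix whose entries $(a_{ij})_{1\le i\le j\le n}$ are independent and Bernoulli distributed with parameter $p_n$ (that is, $a_{ij}=1$ with probability $p_n$ and $a_{ij}=0$ with probability $1-p_n$). Assume there is $\epsilon_0\in(0,1)$ such that, for all sufficiently large $n$, \[ n^{\epsilon_0-1}\le p_n\le \tfrac12 . \] Let $\lambda_1(A)$ denote the largest eigenvalue of $A$. Then $\lambda_1(A)$ is integrable and, as $n\to\infty$, \[ \frac{1}{\sqrt{p_n(1-p_n)}}\bigl(\lambda_1(A)-\mathbb{E}[\lambda_1(A)]\bigr)\Rightarrow N(0,2), \] where $\Rightarrow$ denotes convergence in distribution and $N(0,2)$ is the centered Gaussian law with variance $2$. -/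

import Mathlib

open MeasureTheory ProbabilityTheory Filter

/-- The largest eigenvalue `λ₁(M)` of a real symmetric matrix of size `n ≥ 1`, that is, the maximum
of its (finite, nonempty) spectrum; see `isGreatest_largestEigenvalue`. -/
noncomputable def largestEigenvalue {n : ℕ} (M : Matrix (Fin n) (Fin n) ℝ) : ℝ :=
  sSup (spectrum ℝ M)

theorem isGreatest_largestEigenvalue {n : ℕ} (hn : 0 < n) {M : Matrix (Fin n) (Fin n) ℝ}
    (hM : M.IsHermitian) : IsGreatest (spectrum ℝ M) (largestEigenvalue M) := by
  have : Nonempty (Fin n) := ⟨⟨0, hn⟩⟩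
  have h : spectrum ℝ M = Set.range hM.eigenvalues := hM.spectrum_real_eq_range_eigenvalues
  have hfin : (spectrum ℝ M).Finite := h ▸ Set.finite_range _
  have hne : (spectrum ℝ M).Nonempty := h ▸ Set.range_nonempty _
  exact ⟨hne.csSup_mem hfin, fun _ hx => le_csSup hfin.bddAbove hx⟩

/-- `A` is a random symmetric `n × n` matrix on `(Ω, P)` whose entries `a_ij`, `i ≤ j`, are
independent and Bernoulli distributed with parameter `q`: value `1` with probability `q` and
value `0` with probability `1 - q`. -/
structure IsSymmetricBernoulliMatrix {Ω : Type*} [MeasurableSpace Ω] (P : Measure Ω) {n : ℕ}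
    (q : unitInterval) (A : Ω → Matrix (Fin n) (Fin n) ℝ) : Prop where
  symm : ∀ ω, (A ω).IsSymm
  bernoulli : ∀ i j : Fin n, i ≤ j → HasLaw (fun ω => A ω i j) (bernoulliMeasure (1 : ℝ) 0 q) P
  indep : iIndepFun
    (fun (e : {e : Fin n × Fin n // e.1 ≤ e.2}) (ω : Ω) => A ω e.1.1 e.1.2) P

/-! Let L be the mean degree (∑ a_ij)/n, let d = nq, and write A = qJ + H with J the all-ones matrix
and H the centered matrix. The theorem holds because λ₁ = L + D with D (`eigDev`) of negligible
variance. L is a weighted sum of independent bits with variance (2 - 1/n) q(1-q), and its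
characteristic function, a product over edges, is compared with a Gaussian one factor by factor
(`norm_charFun_meanDegree_sub_le`). It remains to show Var D = o(q), which is
`exists_cubeVar_eigDev_le`.

The variance is controlled by Efron–Stein, without any perturbation series for λ₁. By the
variational principle, toggling the entry e = {i, j} moves λ₁ by an amount lying between the values
of `edgeMult e` · v_i v_j for the top unit eigenvectors v before and after, while L moves by
`edgeMult e` / n. Hence Var D ≤ 2 E ∑ (q + a_ij)(v_i v_j - 1/n)². When the square is expanded, λ₁ ≥
L and E L = nq make all terms of order q cancel, leaving 2 E[w·Hw + (2/n) v·Hv] with w_i = v_i²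
(`cubeVar_eigDev_le`). If ‖H‖ ≤ d^(3/4) and ∑ v_i⁴ = O(1/n), this is O(d^(3/4)/n) = O(q d^(-1/4)),
which is o(q).

Both conditions come from one moment estimate, `cubeExp_centeredMat_pow_mulVec_le`: the 2r-th moment
of an entry of H^k u is O(d^(rk)) when the entries of u are bounded by 1. For u a basis vector it
controls the Frobenius norm of a high power of H, hence ‖H‖. For u = 1 it gives delocalization:
iterating v = (q ∑ v_j / λ₁) 1 + Hv/λ₁ writes v as a short sum of vectors H^k 1 plus a remainder of
size (‖H‖/λ₁)^N. Since d ≥ n^ε, a fixed number of iterations and a fixed power of H suffice. -/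

/-! ### Expectations on the biased discrete cube -/

/-- The mass of `b` under the Bernoulli law with parameter `q`. -/
noncomputable def bernoulliWeight (q : ℝ) (b : Bool) : ℝ := if b then q else 1 - q

/-- The mass of `x` under the product of Bernoulli laws with parameter `q`. -/
noncomputable def cubeWeight {ι : Type*} [Fintype ι] (q : ℝ) (x : ι → Bool) : ℝ :=
  ∏ e, bernoulliWeight q (x e)

/-- The expectation of `f` under the product of Bernoulli laws with parameter `q`. -/
noncomputable def cubeExp {ι : Type*} [Fintype ι] [DecidableEq ι] (q : ℝ)
    (f : (ι → Bool) → ℝ) : ℝ :=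
  ∑ x, cubeWeight q x * f x

section CubeExp

variable {ι : Type*} [Fintype ι]

theorem cubeWeight_nonneg {q : ℝ} (h0 : 0 ≤ q) (h1 : q ≤ 1) (x : ι → Bool) :
    0 ≤ cubeWeight q x := by
  refine Finset.prod_nonneg fun e _ => ?_
  unfold bernoulliWeight
  split_ifs <;> linarith

variable [DecidableEq ι]

theorem sum_prod_bool {R : Type*} [CommSemiring R] (G : ι → Bool → R) :
    ∑ x : ι → Bool, ∏ e, G e (x e) = ∏ e, (G e true + G e false) := by
  have h := Finset.prod_univ_sum (fun _ : ι => (Finset.univ : Finset Bool)) G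
  rw [Fintype.piFinset_univ] at h
  rw [← h]
  simp

theorem cubeExp_prod (q : ℝ) (G : ι → Bool → ℝ) :
    cubeExp q (fun x => ∏ e, G e (x e)) = ∏ e, (q * G e true + (1 - q) * G e false) := by
  simp only [cubeExp, cubeWeight, ← Finset.prod_mul_distrib]
  rw [sum_prod_bool (fun e b => bernoulliWeight q b * G e b)]
  simp [bernoulliWeight]

theorem sum_cubeWeight (q : ℝ) : ∑ x : ι → Bool, cubeWeight q x = 1 := by
  simp only [cubeWeight]
  rw [sum_prod_bool (fun _ b => bernoulliWeight q b)]
  simp [bernoulliWeight]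

theorem cubeExp_const (q c : ℝ) : cubeExp q (fun _ : ι → Bool => c) = c := by
  simp [cubeExp, ← Finset.sum_mul, sum_cubeWeight]

theorem cubeExp_add (q : ℝ) (f g : (ι → Bool) → ℝ) :
    cubeExp q (fun x => f x + g x) = cubeExp q f + cubeExp q g := by
  simp [cubeExp, mul_add, Finset.sum_add_distrib]

theorem cubeExp_sub (q : ℝ) (f g : (ι → Bool) → ℝ) :
    cubeExp q (fun x => f x - g x) = cubeExp q f - cubeExp q g := by
  simp [cubeExp, mul_sub, Finset.sum_sub_distrib]

theorem cubeExp_const_mul (q c : ℝ) (f : (ι → Bool) → ℝ) :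
    cubeExp q (fun x => c * f x) = c * cubeExp q f := by
  simp only [cubeExp, Finset.mul_sum]
  exact Finset.sum_congr rfl fun x _ => by ring

theorem cubeExp_sum {κ : Type*} (s : Finset κ) (q : ℝ) (f : κ → (ι → Bool) → ℝ) :
    cubeExp q (fun x => ∑ k ∈ s, f k x) = ∑ k ∈ s, cubeExp q (f k) := by
  simp only [cubeExp, Finset.mul_sum]
  exact Finset.sum_comm

theorem cubeExp_mono {q : ℝ} (h0 : 0 ≤ q) (h1 : q ≤ 1) {f g : (ι → Bool) → ℝ}
    (h : ∀ x, f x ≤ g x) : cubeExp q f ≤ cubeExp q g :=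
  Finset.sum_le_sum fun x _ => mul_le_mul_of_nonneg_left (h x) (cubeWeight_nonneg h0 h1 x)

theorem cubeExp_nonneg {q : ℝ} (h0 : 0 ≤ q) (h1 : q ≤ 1) {f : (ι → Bool) → ℝ}
    (h : ∀ x, 0 ≤ f x) : 0 ≤ cubeExp q f :=
  Finset.sum_nonneg fun x _ => mul_nonneg (cubeWeight_nonneg h0 h1 x) (h x)

theorem sq_cubeExp_le {q : ℝ} (h0 : 0 ≤ q) (h1 : q ≤ 1) (f : (ι → Bool) → ℝ) :
    cubeExp q f ^ 2 ≤ cubeExp q (fun x => f x ^ 2) := by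
  have h : 0 ≤ cubeExp q (fun x => (f x - cubeExp q f) ^ 2) :=
    cubeExp_nonneg h0 h1 fun x => sq_nonneg _
  have h2 : (fun x => (f x - cubeExp q f) ^ 2)
      = fun x => (f x ^ 2 + (-2 * cubeExp q f) * f x) + cubeExp q f ^ 2 := by
    funext x; ring
  rw [h2, cubeExp_add, cubeExp_add, cubeExp_const_mul, cubeExp_const] at h
  nlinarith

/-- The variance of `f` under the product of Bernoulli laws with parameter `q`. -/
noncomputable def cubeVar (q : ℝ) (f : (ι → Bool) → ℝ) : ℝ :=
  cubeExp q (fun x => (f x - cubeExp q f) ^ 2)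

theorem cubeVar_eq (q : ℝ) (f : (ι → Bool) → ℝ) :
    cubeVar q f = cubeExp q (fun x => f x ^ 2) - cubeExp q f ^ 2 := by
  have h2 : (fun x => (f x - cubeExp q f) ^ 2)
      = fun x => (f x ^ 2 + (-2 * cubeExp q f) * f x) + cubeExp q f ^ 2 := by
    funext x; ring
  rw [cubeVar, h2, cubeExp_add, cubeExp_add, cubeExp_const_mul, cubeExp_const]
  ring

theorem cubeExp_equiv {κ : Type*} [Fintype κ] [DecidableEq κ] (σ : κ ≃ ι) (q : ℝ)
    (f : (ι → Bool) → ℝ) : cubeExp q f = cubeExp q (fun x : κ → Bool => f (x ∘ σ.symm)) := by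
  refine (Fintype.sum_equiv (σ.arrowCongr (Equiv.refl Bool)) _ _ fun x => ?_).symm
  have h : cubeWeight q x = cubeWeight q (x ∘ σ.symm) :=
    Fintype.prod_equiv σ _ _ fun e => by simp
  rw [h]
  rfl

/-- Extend a point of the cube by the value `b` in a new coordinate. -/
def optionCons (b : Bool) (x : ι → Bool) : Option ι → Bool := fun o => o.elim b x

theorem cubeExp_option (q : ℝ) (f : (Option ι → Bool) → ℝ) :
    cubeExp q f = q * cubeExp q (fun x => f (optionCons true x))
      + (1 - q) * cubeExp q (fun x => f (optionCons false x)) := by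
  have h : cubeExp q f = ∑ y : Bool × (ι → Bool),
      (bernoulliWeight q y.1 * cubeWeight q y.2) * f (optionCons y.1 y.2) := by
    refine Fintype.sum_equiv (Equiv.piOptionEquivProd (β := fun _ => Bool)) _ _ fun x => ?_
    have hx : x = optionCons (x none) (fun e => x (some e)) := by
      funext o; cases o <;> rfl
    simp only [cubeWeight, Fintype.prod_option, Equiv.piOptionEquivProd_apply]
    rw [← hx]
  rw [h, Fintype.sum_prod_type]
  simp only [Fintype.sum_bool, bernoulliWeight, cubeExp, Finset.mul_sum]
  simp [mul_assoc]

end CubeExp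

/-! ### Changing one coordinate, and the Efron–Stein inequality -/

theorem optionCons_update_some {ι : Type*} [DecidableEq ι] (b c : Bool) (x : ι → Bool) (e : ι) :
    Function.update (optionCons b x) (some e) c = optionCons b (Function.update x e c) := by
  funext o
  cases o with
  | none => simp [optionCons]
  | some o => by_cases h : o = e <;> simp [optionCons, h]

theorem optionCons_update_none {ι : Type*} [DecidableEq ι] (b c : Bool) (x : ι → Bool) :
    Function.update (optionCons b x) none c = optionCons c x := by
  funext o
  cases o <;> simp [optionCons]

theorem update_comp_symm {ι κ : Type*} [DecidableEq ι] [DecidableEq κ] (σ : κ ≃ ι) (x : κ → Bool)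
    (e : ι) (b : Bool) :
    Function.update (x ∘ σ.symm) e b = Function.update x (σ.symm e) b ∘ σ.symm := by
  funext o
  simp [Function.update_apply]

/-- The **Efron–Stein inequality** on the biased cube. -/
theorem cubeVar_le_sum_sq_update {ι : Type*} [Fintype ι] [DecidableEq ι] {q : ℝ} (h0 : 0 ≤ q)
    (h1 : q ≤ 1) (f : (ι → Bool) → ℝ) :
    cubeVar q f ≤ ∑ e, q * (1 - q) * cubeExp q (fun x =>
      (f (Function.update x e true) - f (Function.update x e false)) ^ 2) := by
  revert f
  rename_i _ inst
  revert inst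
  refine Fintype.induction_empty_option (P := fun ι [Fintype ι] => ∀ [DecidableEq ι]
    (f : (ι → Bool) → ℝ), cubeVar q f ≤ ∑ e, q * (1 - q) * cubeExp q (fun x =>
      (f (Function.update x e true) - f (Function.update x e false)) ^ 2)) ?_ ?_ ?_ ι
  · intro α β _ σ ih _ f
    classical
    let _ : Fintype α := Fintype.ofEquiv β σ.symm
    have h := ih (fun x => f (x ∘ σ.symm))
    rw [cubeVar, cubeExp_equiv σ q f, cubeExp_equiv σ]
    refine h.trans_eq ?_
    refine Fintype.sum_equiv σ _ _ fun e => ?_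
    rw [cubeExp_equiv σ]
    simp [update_comp_symm]
  · intro _ f
    simp [cubeVar, cubeExp, cubeWeight,
      Subsingleton.elim _ (PEmpty.elim : PEmpty → Bool)]
  · intro α _ ih inst f
    classical
    obtain rfl : inst = Option.instDecidableEq := Subsingleton.elim _ _
    have ht := ih (fun x => f (optionCons true x))
    have hf := ih (fun x => f (optionCons false x))
    -- With f₁, f₀ the restrictions of f to the two values of the new coordinate, Var f = q Var f₁ +
    -- (1-q) Var f₀ + q(1-q)(E f₁ - E f₀)². Jensen bounds the last square by E (f₁ - f₀)², the term
    -- of the new coordinate.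
    have hs := sq_cubeExp_le h0 h1 (fun x => f (optionCons true x) - f (optionCons false x))
    rw [cubeExp_sub] at hs
    rw [cubeVar_eq] at ht hf ⊢
    rw [Fintype.sum_option]
    simp only [cubeExp_option q, optionCons_update_none, optionCons_update_some]
    set Et := cubeExp q (fun x => f (optionCons true x))
    set Ef := cubeExp q (fun x => f (optionCons false x))
    simp only [mul_add, Finset.sum_add_distrib]
    have e1 : ∀ (c : ℝ) (g : α → ℝ), ∑ e, q * (1 - q) * (c * g e) = c * ∑ e, q * (1 - q) * g e := by
      intro c g
      rw [Finset.mul_sum]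
      exact Finset.sum_congr rfl fun _ _ => by ring
    rw [e1, e1]
    have h1' : 0 ≤ 1 - q := by linarith
    have k1 := mul_le_mul_of_nonneg_left ht h0
    have k2 := mul_le_mul_of_nonneg_left hf h1'
    have k3 := mul_le_mul_of_nonneg_left hs (mul_nonneg h0 h1')
    nlinarith [k1, k2, k3]

/-- `f (Function.update x e b)` does not depend on `x e`, so the weight of `b` can be absorbed as
the event `x e = b`, on which the update changes nothing. -/
theorem cubeExp_update {ι : Type*} [Fintype ι] [DecidableEq ι] (q : ℝ) (e : ι) (b : Bool)
    (f : (ι → Bool) → ℝ) :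
    bernoulliWeight q b * cubeExp q (fun x => f (Function.update x e b))
      = cubeExp q (fun x => if x e = b then f x else 0) := by
  have hs : (Equiv.optionSubtypeNe e).symm e = none := by simp
  rw [cubeExp_equiv (Equiv.optionSubtypeNe e), cubeExp_equiv (Equiv.optionSubtypeNe e)]
  simp only [update_comp_symm, Function.comp_apply, hs]
  rw [cubeExp_option, cubeExp_option]
  simp only [optionCons_update_none]
  cases b <;> simp only [optionCons, bernoulliWeight] <;> simp [cubeExp_const] <;> left <;> ring

/-! ### Quadratic forms of real symmetric matrices -/

section LinearAlgebra

open Matrix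

theorem isHermitian_of_isSymm {n : ℕ} {M : Matrix (Fin n) (Fin n) ℝ} (hM : M.IsSymm) :
    M.IsHermitian := by
  rw [Matrix.IsHermitian, Matrix.conjTranspose_eq_transpose_of_trivial]
  exact hM

theorem dotProduct_mulVec_le_largestEigenvalue {n : ℕ} (hn : 0 < n)
    {M : Matrix (Fin n) (Fin n) ℝ} (hM : M.IsSymm) (u : Fin n → ℝ) :
    u ⬝ᵥ M *ᵥ u ≤ largestEigenvalue M * (u ⬝ᵥ u) := by
  have hH := isHermitian_of_isSymm hM
  have hg := isGreatest_largestEigenvalue hn hH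
  have hB : (algebraMap ℝ (Matrix (Fin n) (Fin n) ℝ) (largestEigenvalue M) - M).IsHermitian := by
    refine Matrix.IsHermitian.sub ?_ hH
    rw [Algebra.algebraMap_eq_smul_one]
    exact isHermitian_of_isSymm (Matrix.isSymm_one.smul _)
  have hpos : (algebraMap ℝ (Matrix (Fin n) (Fin n) ℝ) (largestEigenvalue M) - M).PosSemidef := by
    rw [hB.posSemidef_iff_eigenvalues_nonneg]
    intro i
    have hi : hB.eigenvalues i ∈ spectrum ℝ
        (algebraMap ℝ (Matrix (Fin n) (Fin n) ℝ) (largestEigenvalue M) - M) := by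
      rw [hB.spectrum_real_eq_range_eigenvalues]
      exact ⟨i, rfl⟩
    rw [← spectrum.singleton_sub_eq] at hi
    obtain ⟨a, ha, b, hb, hab⟩ := Set.mem_sub.1 hi
    rw [Set.mem_singleton_iff] at ha
    have := hg.2 hb
    simp only [Pi.zero_apply]
    linarith
  have h := hpos.dotProduct_mulVec_nonneg u
  rw [Matrix.sub_mulVec, dotProduct_sub, Algebra.algebraMap_eq_smul_one, Matrix.smul_mulVec,
    Matrix.one_mulVec, dotProduct_smul] at h
  simp only [star_trivial, smul_eq_mul] at h
  linarith

theorem exists_unit_eigenvector {n : ℕ} (hn : 0 < n) {M : Matrix (Fin n) (Fin n) ℝ}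
    (hM : M.IsSymm) :
    ∃ v : Fin n → ℝ, v ⬝ᵥ v = 1 ∧ M *ᵥ v = largestEigenvalue M • v := by
  have hH := isHermitian_of_isSymm hM
  have hg := (isGreatest_largestEigenvalue hn hH).1
  rw [hH.spectrum_real_eq_range_eigenvalues] at hg
  obtain ⟨i, hi⟩ := hg
  refine ⟨hH.eigenvectorBasis i, ?_, ?_⟩
  · have h := hH.eigenvectorBasis.norm_eq_one i
    have h2 := EuclideanSpace.real_norm_sq_eq (hH.eigenvectorBasis i)
    rw [h] at h2
    simp only [dotProduct, ← sq]
    linarith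
  · rw [← hi]
    exact hH.mulVec_eigenvectorBasis i

/-- `‖B u‖ ≤ K ‖u‖` for all `u`, in the Euclidean norm. -/
def OpBound {n : ℕ} (B : Matrix (Fin n) (Fin n) ℝ) (K : ℝ) : Prop :=
  ∀ u : Fin n → ℝ, (B *ᵥ u) ⬝ᵥ (B *ᵥ u) ≤ K ^ 2 * (u ⬝ᵥ u)

theorem dotProduct_sq_le {n : ℕ} (u v : Fin n → ℝ) : (u ⬝ᵥ v) ^ 2 ≤ (u ⬝ᵥ u) * (v ⬝ᵥ v) := by
  have h := Finset.sum_mul_sq_le_sq_mul_sq Finset.univ u v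
  simpa only [dotProduct, ← sq] using h

theorem dotProduct_self_nonneg' {n : ℕ} (u : Fin n → ℝ) : 0 ≤ u ⬝ᵥ u :=
  Finset.sum_nonneg fun i _ => mul_self_nonneg (u i)

theorem OpBound.abs_dotProduct_le {n : ℕ} {B : Matrix (Fin n) (Fin n) ℝ} {K : ℝ} (hK : 0 ≤ K)
    (hB : OpBound B K) (u : Fin n → ℝ) : |u ⬝ᵥ B *ᵥ u| ≤ K * (u ⬝ᵥ u) := by
  refine abs_le_of_sq_le_sq ?_ (mul_nonneg hK (dotProduct_self_nonneg' u))
  calc (u ⬝ᵥ B *ᵥ u) ^ 2 ≤ (u ⬝ᵥ u) * ((B *ᵥ u) ⬝ᵥ (B *ᵥ u)) := dotProduct_sq_le _ _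
    _ ≤ (u ⬝ᵥ u) * (K ^ 2 * (u ⬝ᵥ u)) :=
        mul_le_mul_of_nonneg_left (hB u) (dotProduct_self_nonneg' u)
    _ = (K * (u ⬝ᵥ u)) ^ 2 := by ring

theorem OpBound.pow {n : ℕ} {B : Matrix (Fin n) (Fin n) ℝ} {K : ℝ}
    (hB : OpBound B K) (k : ℕ) : OpBound (B ^ k) (K ^ k) := by
  induction k with
  | zero => intro u; simp
  | succ k ih =>
    intro u
    rw [pow_succ', ← Matrix.mulVec_mulVec]
    calc _ ≤ K ^ 2 * ((B ^ k *ᵥ u) ⬝ᵥ (B ^ k *ᵥ u)) := hB _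
      _ ≤ K ^ 2 * ((K ^ k) ^ 2 * (u ⬝ᵥ u)) := mul_le_mul_of_nonneg_left (ih u) (sq_nonneg K)
      _ = _ := by ring

/-! ### Operator norm from the Frobenius norm of a power -/

theorem mulVec_sq_norm_le_frobenius {n : ℕ} (B : Matrix (Fin n) (Fin n) ℝ) (u : Fin n → ℝ) :
    (B *ᵥ u) ⬝ᵥ (B *ᵥ u) ≤ (∑ i, ∑ j, B i j ^ 2) * (u ⬝ᵥ u) := by
  rw [Finset.sum_mul]
  refine Finset.sum_le_sum fun i _ => ?_
  have h := dotProduct_sq_le (B i) u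
  have h2 : B i ⬝ᵥ B i = ∑ j, B i j ^ 2 := by simp only [dotProduct, ← sq]
  rw [← h2]
  calc _ = (B i ⬝ᵥ u) ^ 2 := by rw [sq]; rfl
    _ ≤ _ := h

/-- For symmetric C, ‖Cu‖² = u·C²u ≤ ‖u‖ ‖C²u‖ by Cauchy–Schwarz; repeated squaring of C gives the
powers of two. -/
theorem mulVec_sq_norm_pow_le {n : ℕ} {B : Matrix (Fin n) (Fin n) ℝ} (hB : B.IsSymm) (m : ℕ)
    (u : Fin n → ℝ) :
    ((B *ᵥ u) ⬝ᵥ (B *ᵥ u)) ^ (2 ^ m) ≤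
      (u ⬝ᵥ u) ^ (2 ^ m - 1) * ((B ^ (2 ^ m) *ᵥ u) ⬝ᵥ (B ^ (2 ^ m) *ᵥ u)) := by
  induction m with
  | zero => simp
  | succ m ih =>
    set C := B ^ (2 ^ m) with hC
    have hCs : C.IsSymm := hB.pow _
    have h1 : (C *ᵥ u) ⬝ᵥ (C *ᵥ u) = u ⬝ᵥ (C * C) *ᵥ u := by
      rw [← Matrix.mulVec_mulVec, Matrix.dotProduct_mulVec u C, ← Matrix.mulVec_transpose, hCs]
    have h2 : ((C *ᵥ u) ⬝ᵥ (C *ᵥ u)) ^ 2 ≤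
        (u ⬝ᵥ u) * (((C * C) *ᵥ u) ⬝ᵥ ((C * C) *ᵥ u)) := by
      rw [h1]; exact dotProduct_sq_le _ _
    have hCC : B ^ (2 ^ (m + 1)) = C * C := by rw [hC, ← pow_add]; congr 1; ring
    have hpos : 1 ≤ 2 ^ m := Nat.one_le_two_pow
    rw [hCC]
    calc ((B *ᵥ u) ⬝ᵥ (B *ᵥ u)) ^ (2 ^ (m + 1))
        = (((B *ᵥ u) ⬝ᵥ (B *ᵥ u)) ^ (2 ^ m)) ^ 2 := by rw [← pow_mul]; congr 1
      _ ≤ ((u ⬝ᵥ u) ^ (2 ^ m - 1) * ((C *ᵥ u) ⬝ᵥ (C *ᵥ u))) ^ 2 :=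
          pow_le_pow_left₀ (pow_nonneg (dotProduct_self_nonneg' _) _) ih 2
      _ = ((u ⬝ᵥ u) ^ (2 ^ m - 1)) ^ 2 * ((C *ᵥ u) ⬝ᵥ (C *ᵥ u)) ^ 2 := by ring
      _ ≤ ((u ⬝ᵥ u) ^ (2 ^ m - 1)) ^ 2 * ((u ⬝ᵥ u) * (((C * C) *ᵥ u) ⬝ᵥ ((C * C) *ᵥ u))) :=
          mul_le_mul_of_nonneg_left h2 (sq_nonneg _)
      _ = (u ⬝ᵥ u) ^ (2 ^ (m + 1) - 1) * (((C * C) *ᵥ u) ⬝ᵥ ((C * C) *ᵥ u)) := by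
          rw [← mul_assoc, ← pow_mul, ← pow_succ]
          congr 2
          rw [pow_succ]; omega

/-- The squared Frobenius norm of a power is a polynomial in the entries, so its expectation is
accessible through walk counts. It dominates the operator norm of the power, and symmetry allows the
root to be taken. -/
theorem opBound_of_frobenius_pow_le {n : ℕ} {B : Matrix (Fin n) (Fin n) ℝ} (hB : B.IsSymm)
    (m : ℕ) {K : ℝ} (h : ∑ i, ∑ j, (B ^ (2 ^ m)) i j ^ 2 ≤ (K ^ 2) ^ (2 ^ m)) : OpBound B K := by
  intro u
  have hu := dotProduct_self_nonneg' u
  refine le_of_pow_le_pow_left₀ (n := 2 ^ m) (by positivity) (mul_nonneg (sq_nonneg K) hu) ?_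
  calc _ ≤ (u ⬝ᵥ u) ^ (2 ^ m - 1) * ((B ^ (2 ^ m) *ᵥ u) ⬝ᵥ (B ^ (2 ^ m) *ᵥ u)) :=
        mulVec_sq_norm_pow_le hB m u
    _ ≤ (u ⬝ᵥ u) ^ (2 ^ m - 1) * ((K ^ 2) ^ (2 ^ m) * (u ⬝ᵥ u)) := by
        refine mul_le_mul_of_nonneg_left ?_ (pow_nonneg hu _)
        exact (mulVec_sq_norm_le_frobenius _ u).trans (mul_le_mul_of_nonneg_right h hu)
    _ = (K ^ 2 * (u ⬝ᵥ u)) ^ (2 ^ m) := by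
        have : 2 ^ m = (2 ^ m - 1) + 1 := (Nat.sub_add_cancel Nat.one_le_two_pow).symm
        rw [mul_pow]
        conv_rhs => rw [this, pow_succ (u ⬝ᵥ u), ← this]
        ring

end LinearAlgebra

/-! ### Edges and adjacency matrices -/

/-- The index set of the independent entries of a symmetric matrix. -/
abbrev Edge (n : ℕ) := {e : Fin n × Fin n // e.1 ≤ e.2}

/-- The index of the independent entry at position `(i, j)`. -/
def mkEdge {n : ℕ} (i j : Fin n) : Edge n := ⟨(min i j, max i j), min_le_max⟩

theorem mkEdge_comm {n : ℕ} (i j : Fin n) : mkEdge i j = mkEdge j i := by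
  simp [mkEdge, min_comm, max_comm]

theorem mkEdge_self {n : ℕ} (e : Edge n) : mkEdge e.1.1 e.1.2 = e := by
  apply Subtype.ext
  simp [mkEdge, e.2]

theorem mkEdge_eq_iff {n : ℕ} {i j k l : Fin n} :
    mkEdge i j = mkEdge k l ↔ (i = k ∧ j = l) ∨ (i = l ∧ j = k) := by
  constructor
  · intro h
    have h1 : min i j = min k l := congrArg (fun e : Edge n => e.1.1) h
    have h2 : max i j = max k l := congrArg (fun e : Edge n => e.1.2) h
    rcases le_total i j with hij | hij <;> rcases le_total k l with hkl | hkl <;>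
      simp_all
  · rintro (⟨rfl, rfl⟩ | ⟨rfl, rfl⟩)
    · rfl
    · exact mkEdge_comm _ _

/-- The symmetric `0`-`1` matrix with the prescribed independent entries. -/
def adjMat {n : ℕ} (x : Edge n → Bool) : Matrix (Fin n) (Fin n) ℝ :=
  Matrix.of fun i j => if x (mkEdge i j) then 1 else 0

/-- The number of positions of a symmetric matrix sharing the entry `e`. -/
def edgeMult {n : ℕ} (e : Edge n) : ℝ := if e.1.1 = e.1.2 then 1 else 2

theorem sum_sum_symm_eq_sum_edge {n : ℕ} {F : Fin n → Fin n → ℝ} (hF : ∀ i j, F i j = F j i) :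
    ∑ i, ∑ j, F i j = ∑ e : Edge n, edgeMult e * F e.1.1 e.1.2 := by
  have h1 : ∑ e : Edge n, edgeMult e * F e.1.1 e.1.2 =
      ∑ i, ∑ j, ((if i ≤ j then F i j else 0) + (if i < j then F i j else 0)) := by
    rw [← Fintype.sum_prod_type' (f := fun i j =>
      ((if i ≤ j then F i j else 0) + (if i < j then F i j else 0)))]
    refine (Finset.sum_subtype (p := fun e : Fin n × Fin n => e.1 ≤ e.2)
      (Finset.univ.filter fun e : Fin n × Fin n => e.1 ≤ e.2) (by simp)
      (fun e : Fin n × Fin n => (if e.1 = e.2 then (1 : ℝ) else 2) * F e.1 e.2)).symm.trans ?_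
    rw [Finset.sum_filter]
    refine Finset.sum_congr rfl fun e _ => ?_
    rcases lt_trichotomy e.1 e.2 with h | h | h
    · simp [h, h.le, h.ne]; ring
    · simp [h]
    · simp [not_le.2 h, h.le]
  have h2 : ∑ i, ∑ j, (if i < j then F i j else 0) = ∑ i, ∑ j, (if j < i then F i j else 0) := by
    rw [Finset.sum_comm]
    refine Finset.sum_congr rfl fun i _ => Finset.sum_congr rfl fun j _ => ?_
    rw [hF]
  rw [h1]
  simp only [Finset.sum_add_distrib]
  rw [h2]
  simp only [← Finset.sum_add_distrib]
  refine Finset.sum_congr rfl fun i _ => Finset.sum_congr rfl fun j _ => ?_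
  by_cases h : i ≤ j
  · simp [h, not_lt.2 h]
  · simp [h, not_le.1 h]

section AdjacencyMatrix

open Matrix

variable {n : ℕ}

theorem adjMat_isSymm (x : Edge n → Bool) : (adjMat x).IsSymm := by
  ext i j
  simp [adjMat, mkEdge_comm i j]

theorem adjMat_edge (x : Edge n → Bool) (e : Edge n) :
    adjMat x e.1.1 e.1.2 = if x e then 1 else 0 := by
  simp [adjMat, mkEdge_self]

/-- The matrix `adjMat x` minus its mean. -/
def centeredMat (q : ℝ) (x : Edge n → Bool) : Matrix (Fin n) (Fin n) ℝ :=
  Matrix.of fun i j => adjMat x i j - q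

theorem centeredMat_isSymm (q : ℝ) (x : Edge n → Bool) : (centeredMat q x).IsSymm := by
  ext i j
  simp [centeredMat, (adjMat_isSymm x).apply i j]

theorem abs_centeredMat_le {q : ℝ} (h0 : 0 ≤ q) (h1 : q ≤ 1) (x : Edge n → Bool) (i j : Fin n) :
    |centeredMat q x i j| ≤ 1 := by
  rw [abs_le]
  by_cases h : x (mkEdge i j) <;> simp [centeredMat, adjMat, h] <;> constructor <;> linarith

theorem dotProduct_mulVec_eq_sum (M : Matrix (Fin n) (Fin n) ℝ) (u : Fin n → ℝ) :
    u ⬝ᵥ M *ᵥ u = ∑ i, ∑ j, M i j * (u i * u j) := by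
  simp only [dotProduct, mulVec, Finset.mul_sum]
  exact Finset.sum_congr rfl fun i _ => Finset.sum_congr rfl fun j _ => by ring

theorem dotProduct_adjMat_mulVec (x : Edge n → Bool) (u : Fin n → ℝ) :
    u ⬝ᵥ adjMat x *ᵥ u =
      ∑ e : Edge n, (if x e then 1 else 0) * (edgeMult e * (u e.1.1 * u e.1.2)) := by
  rw [dotProduct_mulVec_eq_sum, sum_sum_symm_eq_sum_edge]
  · refine Finset.sum_congr rfl fun e _ => ?_
    rw [adjMat_edge]; ring
  · intro i j
    rw [(adjMat_isSymm x).apply j i]; ring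

theorem dotProduct_adjMat_update_sub (x : Edge n → Bool) (e : Edge n) (u : Fin n → ℝ) :
    u ⬝ᵥ adjMat (Function.update x e true) *ᵥ u - u ⬝ᵥ adjMat (Function.update x e false) *ᵥ u
      = edgeMult e * (u e.1.1 * u e.1.2) := by
  rw [dotProduct_adjMat_mulVec, dotProduct_adjMat_mulVec, ← Finset.sum_sub_distrib,
    Finset.sum_eq_single e]
  · simp
  · intro b _ hb
    simp [Function.update_of_ne hb]
  · simp

theorem dotProduct_adjMat_eq_add_centered (q : ℝ) (x : Edge n → Bool) (u : Fin n → ℝ) :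
    u ⬝ᵥ adjMat x *ᵥ u = q * (∑ i, u i) ^ 2 + u ⬝ᵥ centeredMat q x *ᵥ u := by
  rw [dotProduct_mulVec_eq_sum, dotProduct_mulVec_eq_sum, sq, Finset.sum_mul_sum, Finset.mul_sum]
  simp only [Finset.mul_sum, ← Finset.sum_add_distrib]
  refine Finset.sum_congr rfl fun i _ => Finset.sum_congr rfl fun j _ => ?_
  simp only [centeredMat, Matrix.of_apply]; ring

open Classical in
/-- A unit eigenvector of `M` for its largest eigenvalue. -/
noncomputable def topVec (M : Matrix (Fin n) (Fin n) ℝ) : Fin n → ℝ :=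
  if h : ∃ v : Fin n → ℝ, v ⬝ᵥ v = 1 ∧ M *ᵥ v = largestEigenvalue M • v then h.choose else 0

theorem topVec_spec (hn : 0 < n) {M : Matrix (Fin n) (Fin n) ℝ} (hM : M.IsSymm) :
    topVec M ⬝ᵥ topVec M = 1 ∧ M *ᵥ topVec M = largestEigenvalue M • topVec M := by
  have h := exists_unit_eigenvector hn hM
  rw [topVec, dif_pos h]
  exact h.choose_spec

theorem dotProduct_topVec (hn : 0 < n) {M : Matrix (Fin n) (Fin n) ℝ} (hM : M.IsSymm) :
    topVec M ⬝ᵥ M *ᵥ topVec M = largestEigenvalue M := by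
  obtain ⟨h1, h2⟩ := topVec_spec hn hM
  rw [h2, dotProduct_smul, h1, smul_eq_mul, mul_one]

theorem dotProduct_topVec_le (hn : 0 < n) {M N : Matrix (Fin n) (Fin n) ℝ} (hM : M.IsSymm)
    (hN : N.IsSymm) : topVec M ⬝ᵥ N *ᵥ topVec M ≤ largestEigenvalue N := by
  have h := dotProduct_mulVec_le_largestEigenvalue hn hN (topVec M)
  rwa [(topVec_spec hn hM).1, mul_one] at h

theorem edgeMult_nonneg (e : Edge n) : 0 ≤ edgeMult e := by
  unfold edgeMult; split_ifs <;> norm_num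

theorem edgeMult_sq_le (e : Edge n) : edgeMult e ^ 2 ≤ 2 * edgeMult e := by
  unfold edgeMult; split_ifs <;> norm_num

/-- The mean of the row sums of `adjMat x`. -/
noncomputable def meanDegree (x : Edge n → Bool) : ℝ := (∑ i, ∑ j, adjMat x i j) / n

theorem dotProduct_one_adjMat (hn : 0 < n) (x : Edge n → Bool) :
    (1 : Fin n → ℝ) ⬝ᵥ adjMat x *ᵥ 1 = n * meanDegree x := by
  have : (n : ℝ) ≠ 0 := by positivity
  rw [dotProduct_mulVec_eq_sum, meanDegree]
  field_simp
  simp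

theorem meanDegree_le_largestEigenvalue (hn : 0 < n) (x : Edge n → Bool) :
    meanDegree x ≤ largestEigenvalue (adjMat x) := by
  have h := dotProduct_mulVec_le_largestEigenvalue hn (adjMat_isSymm x) 1
  rw [dotProduct_one_adjMat hn] at h
  have hn' : (0 : ℝ) < n := by positivity
  simp only [one_dotProduct_one, Fintype.card_fin] at h
  rw [mul_comm] at h
  exact le_of_mul_le_mul_right h hn'

theorem meanDegree_update_sub (hn : 0 < n) (x : Edge n → Bool) (e : Edge n) :
    meanDegree (Function.update x e true) - meanDegree (Function.update x e false)
      = edgeMult e * (1 / n) := by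
  have h := dotProduct_adjMat_update_sub x e 1
  rw [dotProduct_one_adjMat hn, dotProduct_one_adjMat hn] at h
  have : (n : ℝ) ≠ 0 := by positivity
  field_simp
  simp only [Pi.one_apply] at h
  linarith

/-- The deviation of the largest eigenvalue from the mean degree. -/
noncomputable def eigDev (x : Edge n → Bool) : ℝ := largestEigenvalue (adjMat x) - meanDegree x

/-- The squared deviation of `v_i v_j` from `1 / n`, for `v` the top eigenvector of `adjMat x`. -/
noncomputable def prodDev (x : Edge n → Bool) (i j : Fin n) : ℝ :=
  (topVec (adjMat x) i * topVec (adjMat x) j - 1 / n) ^ 2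

/-- Testing each of the two matrices against the top eigenvector of the other traps the increment of
λ₁ between two products v_i v_j times `edgeMult e`. After subtracting the increment of the mean
degree, the difference lies between c·a and c·b, so its square is at most c²(a² + b²). -/
theorem eigDev_update_sub_sq_le (hn : 0 < n) (x : Edge n → Bool) (e : Edge n) :
    (eigDev (Function.update x e true) - eigDev (Function.update x e false)) ^ 2 ≤
      edgeMult e ^ 2 * (prodDev (Function.update x e false) e.1.1 e.1.2
        + prodDev (Function.update x e true) e.1.1 e.1.2) := by
  set x1 := Function.update x e true
  set x0 := Function.update x e false
  have hc := edgeMult_nonneg e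
  have hL := meanDegree_update_sub hn x e
  have hup := dotProduct_adjMat_update_sub x e (topVec (adjMat x1))
  have hlo := dotProduct_adjMat_update_sub x e (topVec (adjMat x0))
  rw [dotProduct_topVec hn (adjMat_isSymm x1)] at hup
  rw [dotProduct_topVec hn (adjMat_isSymm x0)] at hlo
  have h1 := dotProduct_topVec_le hn (adjMat_isSymm x1) (adjMat_isSymm x0)
  have h0 := dotProduct_topVec_le hn (adjMat_isSymm x0) (adjMat_isSymm x1)
  unfold eigDev prodDev
  set a := topVec (adjMat x0) e.1.1 * topVec (adjMat x0) e.1.2 - 1 / n with ha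
  set b := topVec (adjMat x1) e.1.1 * topVec (adjMat x1) e.1.2 - 1 / n with hb
  set c := edgeMult e
  set D := largestEigenvalue (adjMat x1) - meanDegree x1
    - (largestEigenvalue (adjMat x0) - meanDegree x0) with hD
  have hDa : c * a ≤ D := by rw [ha, hD, mul_sub]; linarith
  have hDb : D ≤ c * b := by rw [hb, hD, mul_sub]; linarith
  rcases le_total 0 D with h | h
  · nlinarith [pow_le_pow_left₀ h hDb 2, mul_nonneg (sq_nonneg c) (sq_nonneg a)]
  · nlinarith [pow_le_pow_left₀ (neg_nonneg.2 h) (neg_le_neg hDa) 2,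
      mul_nonneg (sq_nonneg c) (sq_nonneg b)]

theorem prodDev_nonneg (x : Edge n → Bool) (i j : Fin n) : 0 ≤ prodDev x i j := sq_nonneg _

theorem prodDev_comm (x : Edge n → Bool) (i j : Fin n) : prodDev x i j = prodDev x j i := by
  unfold prodDev; ring

/-- In Efron–Stein the weight q(1-q) is split: 1-q turns the value at `false` into at most a plain
expectation, at cost q, while q turns the value at `true` into an expectation against a_ij. The
factor 2 comes from `edgeMult_sq_le`, which turns the sum over edges into one over all pairs (i, j).
-/
theorem cubeVar_eigDev_le_sum (hn : 0 < n) {q : ℝ} (h0 : 0 ≤ q) (h1 : q ≤ 1) :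
    cubeVar q (eigDev (n := n)) ≤
      2 * cubeExp q (fun x : Edge n → Bool => ∑ i, ∑ j, (q + adjMat x i j) * prodDev x i j) := by
  have h1' : 0 ≤ 1 - q := by linarith
  have hsym : ∀ i j : Fin n, cubeExp q (fun x => (q + adjMat x i j) * prodDev x i j)
      = cubeExp q (fun x => (q + adjMat x j i) * prodDev x j i) := by
    intro i j
    congr 1; funext x
    rw [prodDev_comm, (adjMat_isSymm x).apply]
  have hsum := sum_sum_symm_eq_sum_edge hsym
  have hE : cubeExp q (fun x : Edge n → Bool => ∑ i, ∑ j, (q + adjMat x i j) * prodDev x i j)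
      = ∑ i : Fin n, ∑ j : Fin n, cubeExp q (fun x => (q + adjMat x i j) * prodDev x i j) := by
    rw [cubeExp_sum]
    exact Finset.sum_congr rfl fun i _ => cubeExp_sum _ _ _
  rw [hE, hsum, Finset.mul_sum]
  refine (cubeVar_le_sum_sq_update h0 h1 _).trans (Finset.sum_le_sum fun e _ => ?_)
  set g : (Edge n → Bool) → ℝ := fun x => prodDev x e.1.1 e.1.2 with hg
  have hmain : cubeExp q (fun x : Edge n → Bool =>
      (eigDev (Function.update x e true) - eigDev (Function.update x e false)) ^ 2)
      ≤ edgeMult e ^ 2 * (cubeExp q (fun x => g (Function.update x e false))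
        + cubeExp q (fun x => g (Function.update x e true))) := by
    rw [← cubeExp_add, ← cubeExp_const_mul]
    exact cubeExp_mono h0 h1 fun x => eigDev_update_sub_sq_le hn x e
  have hf := cubeExp_update q e false g
  have ht := cubeExp_update q e true g
  simp only [bernoulliWeight, if_true, Bool.false_eq_true, if_false] at hf ht
  set Gf := cubeExp q (fun x => g (Function.update x e false))
  set Gt := cubeExp q (fun x => g (Function.update x e true))
  have hfb : (1 - q) * Gf ≤ cubeExp q g := by
    rw [hf]
    refine cubeExp_mono h0 h1 fun x => ?_
    have := prodDev_nonneg x e.1.1 e.1.2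
    simp only [hg]
    split_ifs <;> linarith
  have htb : q * Gt = cubeExp q (fun x => adjMat x e.1.1 e.1.2 * g x) := by
    rw [ht]; congr 1; funext x
    rw [adjMat_edge]; split_ifs <;> simp
  have hGt : 0 ≤ q * Gt := by
    refine mul_nonneg h0 (cubeExp_nonneg h0 h1 fun x => prodDev_nonneg _ _ _)
  have hsplit : cubeExp q (fun x => (q + adjMat x e.1.1 e.1.2) * prodDev x e.1.1 e.1.2)
      = q * cubeExp q g + q * Gt := by
    rw [htb, ← cubeExp_const_mul, ← cubeExp_add]
    congr 1; funext x; simp only [hg]; ring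
  rw [hsplit]
  have hX : q * (1 - q) * (Gf + Gt) ≤ q * cubeExp q g + q * Gt := by
    nlinarith [mul_le_mul_of_nonneg_left hfb h0, mul_nonneg h0 hGt]
  have hY : 0 ≤ q * cubeExp q g + q * Gt :=
    add_nonneg (mul_nonneg h0 (cubeExp_nonneg h0 h1 fun x => prodDev_nonneg _ _ _)) hGt
  calc _ ≤ q * (1 - q) * (edgeMult e ^ 2 * (Gf + Gt)) :=
        mul_le_mul_of_nonneg_left hmain (mul_nonneg h0 h1')
    _ = edgeMult e ^ 2 * (q * (1 - q) * (Gf + Gt)) := by ring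
    _ ≤ edgeMult e ^ 2 * (q * cubeExp q g + q * Gt) :=
        mul_le_mul_of_nonneg_left hX (sq_nonneg _)
    _ ≤ (2 * edgeMult e) * (q * cubeExp q g + q * Gt) :=
        mul_le_mul_of_nonneg_right (edgeMult_sq_le e) hY
    _ = _ := by ring

/-- The entrywise square of the top eigenvector of `adjMat x`. -/
noncomputable def topVecSq (x : Edge n → Bool) : Fin n → ℝ := fun i => topVec (adjMat x) i ^ 2

theorem sum_topVecSq (hn : 0 < n) (x : Edge n → Bool) : ∑ i, topVecSq x i = 1 := by
  rw [← (topVec_spec hn (adjMat_isSymm x)).1]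
  simp [topVecSq, dotProduct, sq]

/-- Expand (v_i v_j - 1/n)² and substitute A = qJ + H in the quadratic forms of v and of w = (v_i²),
using ∑ w_i = 1. What remains of λ₁ enters with a negative sign, so λ₁ may be replaced by the
smaller mean degree. -/
theorem sum_prodDev_le (hn : 0 < n) (q : ℝ) (x : Edge n → Bool) :
    ∑ i, ∑ j, (q + adjMat x i j) * prodDev x i j ≤
      3 * q - 3 * (meanDegree x / n) + topVecSq x ⬝ᵥ centeredMat q x *ᵥ topVecSq x
        + 2 / n * (topVec (adjMat x) ⬝ᵥ centeredMat q x *ᵥ topVec (adjMat x)) := by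
  have hn0 : (0 : ℝ) < n := by positivity
  set v := topVec (adjMat x) with hv
  have hw := sum_topVecSq hn x
  have hA := dotProduct_topVec hn (adjMat_isSymm x)
  have hA2 := dotProduct_adjMat_eq_add_centered q x v
  have hW := dotProduct_adjMat_eq_add_centered q x (topVecSq x)
  have hL := meanDegree_le_largestEigenvalue hn x
  rw [hw] at hW
  rw [dotProduct_mulVec_eq_sum] at hW
  have hA' : ∑ i, ∑ j, adjMat x i j * (v i * v j) = largestEigenvalue (adjMat x) := by
    rw [← dotProduct_mulVec_eq_sum]; exact hA
  rw [hA] at hA2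
  have hv2 : ∑ i, v i ^ 2 = 1 := hw
  have e1 : ∑ i, ∑ j, q * prodDev x i j = 2 * q - 2 * q * (∑ i, v i) ^ 2 / n := by
    have s1 : ∑ i, ∑ j, (v i ^ 2 * v j ^ 2) = 1 := by
      rw [← Finset.sum_mul_sum, hv2, one_mul]
    have s2 : ∑ i, ∑ j, (v i * v j) = (∑ i, v i) ^ 2 := by
      rw [← Finset.sum_mul_sum, sq]
    have s3 : ∑ i : Fin n, ∑ j : Fin n, (1 / (n : ℝ) ^ 2) = 1 := by
      simp; field_simp
    calc ∑ i, ∑ j, q * prodDev x i j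
        = ∑ i, ∑ j, (q * (v i ^ 2 * v j ^ 2) + (-(2 * q / n)) * (v i * v j)
            + q * (1 / (n : ℝ) ^ 2)) := by
          refine Finset.sum_congr rfl fun i _ => Finset.sum_congr rfl fun j _ => ?_
          rw [prodDev, ← hv]; field_simp; ring
      _ = q * (∑ i, ∑ j, v i ^ 2 * v j ^ 2) + (-(2 * q / n)) * (∑ i, ∑ j, v i * v j)
            + q * (∑ _i : Fin n, ∑ _j : Fin n, 1 / (n : ℝ) ^ 2) := by
          simp only [Finset.sum_add_distrib, Finset.mul_sum]
      _ = q * 1 + (-(2 * q / n)) * (∑ i, v i) ^ 2 + q * 1 := by rw [s1, s2, s3]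
      _ = _ := by ring
  have e2 : ∑ i, ∑ j, adjMat x i j * prodDev x i j
      = (∑ i, ∑ j, adjMat x i j * (topVecSq x i * topVecSq x j))
        - 2 / n * largestEigenvalue (adjMat x) + meanDegree x / n := by
    rw [← hA', meanDegree]
    calc ∑ i, ∑ j, adjMat x i j * prodDev x i j
        = ∑ i, ∑ j, (adjMat x i j * (topVecSq x i * topVecSq x j)
            + (-(2 / n)) * (adjMat x i j * (v i * v j)) + (1 / (n : ℝ) ^ 2) * adjMat x i j) := by
          refine Finset.sum_congr rfl fun i _ => Finset.sum_congr rfl fun j _ => ?_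
          simp only [prodDev, topVecSq, ← hv]; field_simp; ring
      _ = _ := by
          simp only [Finset.sum_add_distrib, ← Finset.mul_sum]
          field_simp; ring
  simp only [add_mul, Finset.sum_add_distrib]
  rw [e1, e2, hW]
  have hs : (∑ i, v i) ^ 2 * q = largestEigenvalue (adjMat x) - v ⬝ᵥ centeredMat q x *ᵥ v := by
    linarith
  have h1 : 2 * q * (∑ i, v i) ^ 2 / n
      = 2 / n * (largestEigenvalue (adjMat x) - v ⬝ᵥ centeredMat q x *ᵥ v) := by
    rw [← hs]; ring
  rw [h1]
  have h2 : 2 / (n : ℝ) * meanDegree x ≤ 2 / n * largestEigenvalue (adjMat x) :=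
    mul_le_mul_of_nonneg_left hL (by positivity)
  have h3 : 2 / (n : ℝ) * meanDegree x = 2 * (meanDegree x / n) := by ring
  linarith

theorem cubeExp_adjMat (q : ℝ) (i j : Fin n) : cubeExp q (fun x => adjMat x i j) = q := by
  have h := cubeExp_update q (mkEdge i j) true (fun _ : Edge n → Bool => (1 : ℝ))
  rw [cubeExp_const] at h
  simpa [adjMat, bernoulliWeight] using h.symm

theorem cubeExp_meanDegree (hn : 0 < n) (q : ℝ) :
    cubeExp q (meanDegree (n := n)) = n * q := by
  have hn0 : (0 : ℝ) < n := by positivity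
  have : (meanDegree (n := n)) = fun x => (1 / (n : ℝ)) * ∑ i, ∑ j, adjMat x i j := by
    funext x; rw [meanDegree]; ring
  rw [this, cubeExp_const_mul, cubeExp_sum]
  simp only [cubeExp_sum, cubeExp_adjMat]
  simp; field_simp

/-- The term 3q - 3L/n has expectation zero. This exact cancellation is what improves the trivial
order q to o(q). -/
theorem cubeVar_eigDev_le (hn : 0 < n) {q : ℝ} (h0 : 0 ≤ q) (h1 : q ≤ 1) :
    cubeVar q (eigDev (n := n)) ≤
      2 * cubeExp q (fun x : Edge n → Bool => topVecSq x ⬝ᵥ centeredMat q x *ᵥ topVecSq x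
        + 2 / n * (topVec (adjMat x) ⬝ᵥ centeredMat q x *ᵥ topVec (adjMat x))) := by
  have hn0 : (0 : ℝ) < n := by positivity
  refine (cubeVar_eigDev_le_sum hn h0 h1).trans ?_
  refine mul_le_mul_of_nonneg_left ?_ zero_le_two
  refine (cubeExp_mono h0 h1 (sum_prodDev_le hn q)).trans_eq ?_
  have : (fun x : Edge n → Bool => 3 * q - 3 * (meanDegree x / n)
      + topVecSq x ⬝ᵥ centeredMat q x *ᵥ topVecSq x
        + 2 / n * (topVec (adjMat x) ⬝ᵥ centeredMat q x *ᵥ topVec (adjMat x)))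
      = fun x => (3 * q + (-(3 / n)) * meanDegree x)
        + (topVecSq x ⬝ᵥ centeredMat q x *ᵥ topVecSq x
        + 2 / n * (topVec (adjMat x) ⬝ᵥ centeredMat q x *ᵥ topVec (adjMat x))) := by
    funext x; ring
  rw [this, cubeExp_add, cubeExp_add, cubeExp_const, cubeExp_const_mul, cubeExp_meanDegree hn]
  field_simp
  ring

end AdjacencyMatrix

/-! ### Moments of walk sums of the centered matrix -/

section Moments

/-- A centered Bernoulli variable. -/
def centeredBit (q : ℝ) (b : Bool) : ℝ := (if b then 1 else 0) - q

theorem abs_centeredBit_moment_le {q : ℝ} (h0 : 0 ≤ q) (h1 : q ≤ 1) {m : ℕ} (hm : 2 ≤ m) :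
    |q * centeredBit q true ^ m + (1 - q) * centeredBit q false ^ m| ≤ q := by
  have h1' : 0 ≤ 1 - q := by linarith
  simp only [centeredBit, if_true, Bool.false_eq_true, if_false, zero_sub]
  have ha : (1 - q) ^ m ≤ 1 - q := pow_le_of_le_one h1' (by linarith) (by omega)
  have hb : q ^ m ≤ q ^ 2 := pow_le_pow_of_le_one h0 h1 hm
  calc |q * (1 - q) ^ m + (1 - q) * (-q) ^ m|
      ≤ |q * (1 - q) ^ m| + |(1 - q) * (-q) ^ m| := abs_add_le _ _
    _ = q * (1 - q) ^ m + (1 - q) * q ^ m := by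
        rw [abs_mul, abs_mul, abs_pow, abs_pow, abs_neg, abs_of_nonneg h0, abs_of_nonneg h1']
    _ ≤ q * (1 - q) + (1 - q) * q ^ 2 := by gcongr
    _ ≤ q := by nlinarith [pow_nonneg h0 3]

/-- Group the factors by coordinate. A coordinate used exactly once has mean zero and kills the
product; otherwise each used coordinate occurs at least twice, contributes at most q, and at most
half as many coordinates as factors occur. -/
theorem abs_cubeExp_prod_centeredBit_le {ι τ : Type*} [Fintype ι] [DecidableEq ι] [Fintype τ]
    {q : ℝ} (h0 : 0 ≤ q) (h1 : q ≤ 1) (g : τ → ι) :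
    |cubeExp q (fun x => ∏ t, centeredBit q (x (g t)))| ≤
      if 2 * (Finset.univ.image g).card ≤ Fintype.card τ
        then q ^ (Finset.univ.image g).card else 0 := by
  set mult : ι → ℕ := fun e => (Finset.univ.filter fun t => g t = e).card with hmult
  have hprod : (fun x : ι → Bool => ∏ t, centeredBit q (x (g t)))
      = fun x => ∏ e, centeredBit q (x e) ^ mult e := by
    funext x
    rw [← Finset.prod_fiberwise Finset.univ g]
    refine Finset.prod_congr rfl fun e _ => ?_
    rw [hmult, ← Finset.prod_const]
    refine Finset.prod_congr rfl fun t ht => ?_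
    rw [(Finset.mem_filter.1 ht).2]
  rw [hprod, cubeExp_prod q (fun e b => centeredBit q b ^ mult e)]
  by_cases h : ∃ e, mult e = 1
  · obtain ⟨e, he⟩ := h
    rw [Finset.prod_eq_zero (Finset.mem_univ e)]
    · rw [abs_zero]; split_ifs
      · positivity
      · exact le_rfl
    · rw [he]; simp [centeredBit]; ring
  · push Not at h
    have hmem : ∀ e, e ∈ Finset.univ.image g ↔ mult e ≠ 0 := by
      intro e
      simp [hmult, Finset.filter_eq_empty_iff]
    have hcard : 2 * (Finset.univ.image g).card ≤ Fintype.card τ := by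
      rw [← Finset.card_univ,
        Finset.card_eq_sum_card_image g Finset.univ, mul_comm, ← smul_eq_mul]
      refine Finset.card_nsmul_le_sum _ _ _ fun e he => ?_
      have h2 := (hmem e).1 he
      have h3 := h e
      simp only [hmult] at h2 h3
      omega
    rw [if_pos hcard, Finset.abs_prod]
    calc _ ≤ ∏ e, (if e ∈ Finset.univ.image g then q else 1) := by
          refine Finset.prod_le_prod (fun _ _ => abs_nonneg _) fun e _ => ?_
          split_ifs with he
          · have h2 := (hmem e).1 he
            have h3 := h e
            exact abs_centeredBit_moment_le h0 h1 (by omega)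
          · rw [hmem, not_not] at he
            simp [he]
      _ = _ := by
          rw [Finset.prod_ite_mem, Finset.univ_inter, Finset.prod_const]

/-- Vertices are chosen one at a time, S collecting those already seen: an old vertex costs 1 and
has |S| choices, while the new ones cost 1/|V| each and contribute at most 1 in total. -/
theorem sum_inv_pow_card_image_sdiff_le {V : Type*} [Fintype V] [DecidableEq V] [Nonempty V]
    (m : ℕ) (S : Finset V) :
    ∑ Z : Fin m → V, ((Fintype.card V : ℝ)⁻¹) ^ (Finset.univ.image Z \ S).card
      ≤ ((S.card : ℝ) + m) ^ m := by
  have hV : (0 : ℝ) < Fintype.card V := by exact_mod_cast Fintype.card_pos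
  induction m generalizing S with
  | zero => simp
  | succ m ih =>
    set a : ℝ := (Fintype.card V : ℝ)⁻¹ with ha
    have hcons : ∑ Z : Fin (m + 1) → V, a ^ (Finset.univ.image Z \ S).card
        = ∑ z : V, ∑ Z : Fin m → V, (if z ∈ S then 1 else a) *
            a ^ (Finset.univ.image Z \ insert z S).card := by
      rw [← Fintype.sum_prod_type', ← (Fin.consEquiv fun _ => V).sum_comp]
      refine Fintype.sum_congr _ _ fun y => ?_
      obtain ⟨z, Z⟩ := y
      have him : Finset.univ.image (Fin.cons z Z : Fin (m + 1) → V)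
          = insert z (Finset.univ.image Z) := by
        ext w
        simp [Fin.exists_fin_succ, eq_comm]
      have : Finset.univ.image ((Fin.consEquiv fun _ => V) (z, Z))
          = insert z (Finset.univ.image Z) := him
      rw [this]
      by_cases hz : z ∈ S
      · simp [hz, Finset.insert_sdiff_of_mem]
      · have : insert z (Finset.univ.image Z) \ S
            = insert z (Finset.univ.image Z \ insert z S) := by
          ext w
          by_cases hw : w = z <;> simp [hw, hz]
        rw [this, Finset.card_insert_of_notMem (by simp)]
        simp [hz, pow_succ']
    rw [hcons]
    have ha0 : 0 ≤ a := by positivity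
    have hbase : ∑ z : V, (if z ∈ S then (1 : ℝ) else a) ≤ S.card + 1 := by
      calc _ ≤ ∑ z : V, ((if z ∈ S then (1 : ℝ) else 0) + a) := by
            refine Finset.sum_le_sum fun z _ => ?_
            split_ifs <;> linarith
        _ = S.card + 1 := by
            rw [Finset.sum_add_distrib]
            simp [ha]
    have hstep : ∀ z : V, ∑ Z : Fin m → V, (if z ∈ S then 1 else a) *
        a ^ (Finset.univ.image Z \ insert z S).card
        ≤ (if z ∈ S then 1 else a) * ((S.card : ℝ) + (m + 1 : ℕ)) ^ m := by
      intro z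
      rw [← Finset.mul_sum]
      refine mul_le_mul_of_nonneg_left ((ih (insert z S)).trans ?_) (by split_ifs <;> linarith)
      refine pow_le_pow_left₀ (by positivity) ?_ m
      have : ((insert z S).card : ℝ) ≤ S.card + 1 := by exact_mod_cast Finset.card_insert_le z S
      push_cast; linarith
    refine (Finset.sum_le_sum fun z _ => hstep z).trans ?_
    rw [← Finset.sum_mul, pow_succ']
    refine mul_le_mul_of_nonneg_right (hbase.trans ?_) (by positivity)
    push_cast
    have : (0 : ℝ) ≤ m := by positivity
    linarith

/-! ### Walks, their edges and the moments of H^k u -/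

variable {n : ℕ}

/-- The edge used in step `t` of the walk that starts in `i` and then visits `y`. -/
def walkEdge {k : ℕ} (i : Fin n) (y : Fin k → Fin n) (t : Fin k) : Edge n :=
  mkEdge ((Fin.cons i y : Fin (k + 1) → Fin n) t.castSucc) (y t)

theorem exists_lt_of_cons_castSucc_eq {k : ℕ} {i w : Fin n} {y : Fin k → Fin n} {t : Fin k}
    (h : (Fin.cons i y : Fin (k + 1) → Fin n) t.castSucc = w) (hw : w ≠ i) :
    ∃ t', t' < t ∧ y t' = w := by
  obtain ⟨t, ht⟩ := t
  cases t with
  | zero => exact absurd h.symm hw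
  | succ t => exact ⟨⟨t, by omega⟩, by simp [Fin.lt_def], h⟩

/-- All walks start at i, so their union is connected. Each vertex other than i is sent to an edge
entering it at its earliest step over all walks. -/
theorem card_image_sdiff_le_card_walkEdge {r k : ℕ} (i : Fin n) (Y : Fin r → Fin k → Fin n) :
    (Finset.univ.image (fun p : Fin r × Fin k => Y p.1 p.2) \ {i}).card ≤
      (Finset.univ.image (fun p : Fin r × Fin k => walkEdge i (Y p.1) p.2)).card := by
  set R := Finset.univ.image (fun p : Fin r × Fin k => Y p.1 p.2) \ {i} with hR
  have hex : ∀ y ∈ R, ∃ p : Fin r × Fin k, Y p.1 p.2 = y ∧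
      ∀ p' : Fin r × Fin k, Y p'.1 p'.2 = y → p.2 ≤ p'.2 := by
    intro y hy
    obtain ⟨hy1, -⟩ := Finset.mem_sdiff.1 hy
    obtain ⟨p0, -, hp0⟩ := Finset.mem_image.1 hy1
    obtain ⟨p, hp, hmin⟩ := Finset.exists_min_image
      (Finset.univ.filter fun p : Fin r × Fin k => Y p.1 p.2 = y) (fun p => p.2)
      ⟨p0, by simpa using hp0⟩
    refine ⟨p, by simpa using hp, fun p' hp' => hmin p' (by simpa using hp')⟩
  rcases R.eq_empty_or_nonempty with h | ⟨y0, hy0⟩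
  · simp [h]
  have : Nonempty (Fin r × Fin k) := ⟨(hex y0 hy0).choose⟩
  choose! p hp hmin using hex
  refine Finset.card_le_card_of_injOn (fun y => walkEdge i (Y (p y).1) (p y).2) ?_ ?_
  · intro y _
    exact Finset.mem_coe.2 (Finset.mem_image_of_mem
      (fun p : Fin r × Fin k => walkEdge i (Y p.1) p.2) (Finset.mem_univ (p y)))
  · have key : ∀ y ∈ R, ∀ y' ∈ R,
        (Fin.cons i (Y (p y).1) : Fin (k + 1) → Fin n) (p y).2.castSucc = y' →
        (p y').2 < (p y).2 := by
      intro y _ y' hy' h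
      have hne : y' ≠ i := by simpa using (Finset.mem_sdiff.1 hy').2
      obtain ⟨t', ht', hyt⟩ := exists_lt_of_cons_castSucc_eq h hne
      exact (hmin y' hy' ((p y).1, t') hyt).trans_lt ht'
    intro y hy y' hy' h
    have hy := Finset.mem_coe.1 hy
    have hy' := Finset.mem_coe.1 hy'
    simp only [walkEdge, hp y hy, hp y' hy'] at h
    rcases mkEdge_eq_iff.1 h with ⟨-, h2⟩ | ⟨h1, h2⟩
    · exact h2
    -- If two vertices shared their entering edge with opposite orientations, each would have been
    -- reached strictly before the other.
    · exact absurd (key y hy y' hy' h1) (not_lt.2 (key y' hy' y hy h2.symm).le)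

open Matrix

theorem centeredMat_apply_eq (q : ℝ) (x : Edge n → Bool) (i j : Fin n) :
    centeredMat q x i j = centeredBit q (x (mkEdge i j)) := by
  simp [centeredMat, adjMat, centeredBit]

theorem centeredMat_pow_mulVec (q : ℝ) (x : Edge n → Bool) (u : Fin n → ℝ) (k : ℕ) (i : Fin n) :
    (centeredMat q x ^ k *ᵥ u) i = ∑ y : Fin k → Fin n,
      (∏ t, centeredBit q (x (walkEdge i y t))) *
        u ((Fin.cons i y : Fin (k + 1) → Fin n) (Fin.last k)) := by
  induction k generalizing i with
  | zero => simp
  | succ k ih =>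
    rw [pow_succ', ← Matrix.mulVec_mulVec, Matrix.mulVec, dotProduct,
      ← (Fin.consEquiv fun _ => Fin n).sum_comp, Fintype.sum_prod_type]
    refine Fintype.sum_congr _ _ fun j => ?_
    rw [ih, Finset.mul_sum]
    refine Fintype.sum_congr _ _ fun y => ?_
    change _ = (∏ t, centeredBit q (x (walkEdge i (Fin.cons j y : Fin (k + 1) → Fin n) t))) * _
    rw [Fin.prod_univ_succ, centeredMat_apply_eq, ← mul_assoc]
    rfl

/-- The moment is a sum over 2r walks of length k from i. With D distinct edges and ρ vertices other
than i, a nonzero term has ρ ≤ D ≤ rk and size at most q^D ≤ d^(rk) n^(-ρ), where d = nq. The sum of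
n^(-ρ) over all vertex choices depends only on r and k. -/
theorem cubeExp_centeredMat_pow_mulVec_le {q : ℝ} (h0 : 0 ≤ q) (h1 : q ≤ 1) (hd : 1 ≤ n * q)
    {u : Fin n → ℝ} (hu : ∀ j, |u j| ≤ 1) (k r : ℕ) (i : Fin n) :
    cubeExp q (fun x => (centeredMat q x ^ k *ᵥ u) i ^ (2 * r)) ≤
      (1 + 2 * r * k : ℝ) ^ (2 * r * k) * (n * q) ^ (r * k) := by
  have hn0 : (0 : ℝ) < n := by
    rcases Nat.eq_zero_or_pos n with h | h
    · subst h; exact i.elim0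
    · exact_mod_cast h
  have : Nonempty (Fin n) := ⟨i⟩
  have hexp : (fun x => (centeredMat q x ^ k *ᵥ u) i ^ (2 * r))
      = fun x => ∑ Y : Fin (2 * r) → Fin k → Fin n,
        (∏ s, u ((Fin.cons i (Y s) : Fin (k + 1) → Fin n) (Fin.last k))) *
        ∏ p : Fin (2 * r) × Fin k, centeredBit q (x (walkEdge i (Y p.1) p.2)) := by
    funext x
    rw [centeredMat_pow_mulVec, Fintype.sum_pow]
    refine Fintype.sum_congr _ _ fun Y => ?_
    rw [Finset.prod_mul_distrib, mul_comm, Fintype.prod_prod_type]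
  rw [hexp, cubeExp_sum]
  have hterm : ∀ Y : Fin (2 * r) → Fin k → Fin n,
      cubeExp q (fun x => (∏ s, u ((Fin.cons i (Y s) : Fin (k + 1) → Fin n) (Fin.last k))) *
        ∏ p : Fin (2 * r) × Fin k, centeredBit q (x (walkEdge i (Y p.1) p.2)))
      ≤ (n * q) ^ (r * k) * ((Fintype.card (Fin n) : ℝ)⁻¹) ^
        (Finset.univ.image (fun p : Fin (2 * r) × Fin k => Y p.1 p.2) \ {i}).card := by
    intro Y
    rw [cubeExp_const_mul]
    refine (le_abs_self _).trans ?_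
    rw [abs_mul, Finset.abs_prod]
    have hone : ∏ s, |u ((Fin.cons i (Y s) : Fin (k + 1) → Fin n) (Fin.last k))| ≤ 1 :=
      Finset.prod_le_one (fun _ _ => abs_nonneg _) fun _ _ => hu _
    refine (mul_le_of_le_one_left (abs_nonneg _) hone).trans ?_
    refine (abs_cubeExp_prod_centeredBit_le h0 h1
      (fun p : Fin (2 * r) × Fin k => walkEdge i (Y p.1) p.2)).trans ?_
    have hcard := card_image_sdiff_le_card_walkEdge i Y
    set D := (Finset.univ.image (fun p : Fin (2 * r) × Fin k => walkEdge i (Y p.1) p.2)).card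
    set ρ := (Finset.univ.image (fun p : Fin (2 * r) × Fin k => Y p.1 p.2) \ {i}).card
    split_ifs with hD
    · simp only [Fintype.card_prod, Fintype.card_fin] at hD ⊢
      have hρ : ρ ≤ r * k := by nlinarith
      calc q ^ D ≤ q ^ ρ := pow_le_pow_of_le_one h0 h1 hcard
        _ = (n * q) ^ ρ * ((n : ℝ)⁻¹) ^ ρ := by
            rw [← mul_pow]; congr 1; field_simp
        _ ≤ _ := mul_le_mul_of_nonneg_right (pow_le_pow_right₀ hd hρ) (by positivity)
    · positivity
  refine (Finset.sum_le_sum fun Y _ => hterm Y).trans ?_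
  rw [← Finset.mul_sum, mul_comm]
  refine mul_le_mul_of_nonneg_right ?_ (by positivity)
  have h := sum_inv_pow_card_image_sdiff_le (V := Fin n) (2 * r * k) {i}
  -- The 2r walks are concatenated into one sequence of 2rk vertices, with S = {i}.
  rw [← ((Equiv.curry (Fin (2 * r)) (Fin k) (Fin n)).symm.trans
    (Equiv.arrowCongr finProdFinEquiv (Equiv.refl (Fin n)))).sum_comp] at h
  refine le_trans (le_of_eq ?_) (h.trans_eq ?_)
  · refine Fintype.sum_congr _ _ fun Y => ?_
    congr 3
    ext w
    simp only [Finset.mem_image, Finset.mem_univ, true_and]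
    constructor
    · rintro ⟨p, hp⟩
      exact ⟨finProdFinEquiv p, by simpa [Function.uncurry] using hp⟩
    · rintro ⟨a, ha⟩
      exact ⟨finProdFinEquiv.symm a, by simpa [Function.uncurry] using ha⟩
  · push_cast
    simp

end Moments

/-! ### Delocalization of the top eigenvector and the variance bound -/

section Delocalization

open Matrix

variable {n : ℕ}

theorem sum_pow_four_le (N : ℕ) (a : ℕ → ℝ) :
    (∑ k ∈ Finset.range N, a k) ^ 4 ≤ (N : ℝ) ^ 3 * ∑ k ∈ Finset.range N, a k ^ 4 := by
  have h1 := sq_sum_le_card_mul_sum_sq (s := Finset.range N) (f := a)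
  have h2 := sq_sum_le_card_mul_sum_sq (s := Finset.range N) (f := fun k => a k ^ 2)
  rw [Finset.card_range] at h1 h2
  have h3 : ∀ k, (a k ^ 2) ^ 2 = a k ^ 4 := fun k => by ring
  simp only [h3] at h2
  calc (∑ k ∈ Finset.range N, a k) ^ 4 = ((∑ k ∈ Finset.range N, a k) ^ 2) ^ 2 := by ring
    _ ≤ (N * ∑ k ∈ Finset.range N, a k ^ 2) ^ 2 := pow_le_pow_left₀ (sq_nonneg _) h1 2
    _ = (N : ℝ) ^ 2 * (∑ k ∈ Finset.range N, a k ^ 2) ^ 2 := by ring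
    _ ≤ (N : ℝ) ^ 2 * (N * ∑ k ∈ Finset.range N, a k ^ 4) :=
        mul_le_mul_of_nonneg_left h2 (sq_nonneg _)
    _ = _ := by ring

theorem add_pow_four_le (a b : ℝ) : (a + b) ^ 4 ≤ 8 * (a ^ 4 + b ^ 4) := by
  nlinarith [sq_nonneg (a - b), sq_nonneg (a + b), sq_nonneg (a ^ 2 - b ^ 2),
    mul_nonneg (sq_nonneg (a - b)) (sq_nonneg (a + b)), sq_nonneg ((a - b) ^ 2)]

theorem centeredMat_mulVec_topVec (hn : 0 < n) (q : ℝ) (x : Edge n → Bool) :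
    centeredMat q x *ᵥ topVec (adjMat x) = largestEigenvalue (adjMat x) • topVec (adjMat x)
      - (q * ∑ i, topVec (adjMat x) i) • 1 := by
  rw [← (topVec_spec hn (adjMat_isSymm x)).2]
  funext i
  simp only [mulVec, dotProduct, centeredMat, Matrix.of_apply, Pi.sub_apply, Pi.smul_apply,
    Pi.one_apply, smul_eq_mul, sub_mul, Finset.sum_sub_distrib, Finset.mul_sum, mul_one]

/-- Iterates v = (q ∑ v_j / λ₁) 1 + Hv/λ₁, the eigenvalue equation for A = qJ + H. -/
theorem topVec_expansion (hn : 0 < n) (q : ℝ) (x : Edge n → Bool)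
    (hl : largestEigenvalue (adjMat x) ≠ 0) (N : ℕ) (i : Fin n) :
    topVec (adjMat x) i = (∑ k ∈ Finset.range N,
      (q * ∑ j, topVec (adjMat x) j) / largestEigenvalue (adjMat x) ^ (k + 1) *
        (centeredMat q x ^ k *ᵥ 1) i)
      + (centeredMat q x ^ N *ᵥ topVec (adjMat x)) i / largestEigenvalue (adjMat x) ^ N := by
  induction N with
  | zero => simp
  | succ N ih =>
    rw [Finset.sum_range_succ, pow_succ (centeredMat q x), ← Matrix.mulVec_mulVec,
      centeredMat_mulVec_topVec hn, Matrix.mulVec_sub, Matrix.mulVec_smul, Matrix.mulVec_smul]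
    refine ih.trans ?_
    simp only [Pi.sub_apply, Pi.smul_apply, smul_eq_mul]
    field_simp
    ring

theorem sum_pow_four_le_sq_sum_sq (u : Fin n → ℝ) : ∑ i, u i ^ 4 ≤ (u ⬝ᵥ u) ^ 2 := by
  have h := Finset.sum_sq_le_sq_sum_of_nonneg (s := Finset.univ) (f := fun i => u i ^ 2)
    (fun i _ => sq_nonneg _)
  have h2 : ∀ i, (u i ^ 2) ^ 2 = u i ^ 4 := fun i => by ring
  simp only [h2] at h
  simpa only [dotProduct, ← sq] using h

theorem largestEigenvalue_ge_of_opBound (hn : 0 < n) {q K : ℝ} (hK : 0 ≤ K) {x : Edge n → Bool}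
    (hB : OpBound (centeredMat q x) K) : n * q - K ≤ largestEigenvalue (adjMat x) := by
  have hn0 : (0 : ℝ) < n := by positivity
  have h1 := dotProduct_mulVec_le_largestEigenvalue hn (adjMat_isSymm x) 1
  have h2 := (abs_le.1 (hB.abs_dotProduct_le hK 1)).1
  rw [dotProduct_adjMat_eq_add_centered q] at h1
  simp only [one_dotProduct_one, Fintype.card_fin, Pi.one_apply, Finset.sum_const,
    Finset.card_univ, nsmul_eq_mul, mul_one] at h1 h2
  have : n * (n * q - K) ≤ n * largestEigenvalue (adjMat x) := by nlinarith
  exact le_of_mul_le_mul_left this hn0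

theorem sq_sum_topVec_le (hn : 0 < n) (x : Edge n → Bool) :
    (∑ i, topVec (adjMat x) i) ^ 2 ≤ n := by
  have h := sq_sum_le_card_mul_sum_sq (s := Finset.univ) (f := topVec (adjMat x))
  have h2 := sum_topVecSq hn x
  simp only [topVecSq] at h2
  rw [h2] at h
  simpa using h

/-- Delocalization of the top eigenvector in `ℓ⁴`, in terms of the iterates `H ^ k 1`. -/
theorem sum_topVec_pow_four_le (hn : 0 < n) {q δ : ℝ} (hδ : 2 ≤ δ) (hd : δ ^ 4 = n * q)
    {x : Edge n → Bool} (hB : OpBound (centeredMat q x) (δ ^ 3)) (N : ℕ) :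
    ∑ i, topVec (adjMat x) i ^ 4 ≤
      8 * ((N : ℝ) ^ 3 * ∑ k ∈ Finset.range N, 16 ^ (k + 1) / ((n : ℝ) ^ 2 * (n * q) ^ (4 * k)) *
        ∑ i, (centeredMat q x ^ k *ᵥ 1) i ^ 4) + 8 * (16 ^ N / δ ^ (4 * N)) := by
  have hn0 : (0 : ℝ) < n := by positivity
  have hδ0 : 0 < δ := by linarith
  set l := largestEigenvalue (adjMat x) with hl
  set v := topVec (adjMat x) with hv
  set s := ∑ j, v j with hs
  have hd0 : 0 < n * q := by rw [← hd]; positivity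
  -- Since δ ≥ 2, the norm bound δ³ is at most half of d = δ⁴.
  have hlge : (n * q) / 2 ≤ l := by
    have h := largestEigenvalue_ge_of_opBound hn (by positivity) hB
    have h2 : δ ^ 3 ≤ δ ^ 4 / 2 := by nlinarith [pow_pos hδ0 3]
    rw [← hd] at h ⊢
    linarith
  have hl0 : 0 < l := lt_of_lt_of_le (by positivity) hlge
  have hs2 : s ^ 2 ≤ n := sq_sum_topVec_le hn x
  have hs4 : s ^ 4 ≤ (n : ℝ) ^ 2 := by
    calc s ^ 4 = (s ^ 2) ^ 2 := by ring
      _ ≤ _ := pow_le_pow_left₀ (sq_nonneg _) hs2 2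
  have hinv : ∀ m : ℕ, 1 / l ^ m ≤ 2 ^ m / (n * q) ^ m := by
    intro m
    rw [div_le_div_iff₀ (by positivity) (by positivity), ← mul_pow, one_mul]
    exact pow_le_pow_left₀ hd0.le (by linarith) m
  have hcoef : ∀ k : ℕ, (q * s / l ^ (k + 1)) ^ 4
      ≤ 16 ^ (k + 1) / ((n : ℝ) ^ 2 * (n * q) ^ (4 * k)) := by
    intro k
    have hq4 : 0 ≤ q ^ 4 := by positivity
    calc (q * s / l ^ (k + 1)) ^ 4 = q ^ 4 * s ^ 4 * (1 / l ^ (4 * (k + 1))) := by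
          rw [div_pow, mul_pow, ← pow_mul, mul_comm (k + 1) 4]; ring
      _ ≤ q ^ 4 * (n : ℝ) ^ 2 * (2 ^ (4 * (k + 1)) / (n * q) ^ (4 * (k + 1))) := by
          refine mul_le_mul (mul_le_mul_of_nonneg_left hs4 hq4) (hinv _) (by positivity)
            (by positivity)
      _ = 16 ^ (k + 1) / ((n : ℝ) ^ 2 * (n * q) ^ (4 * k)) := by
          have hq0 : q ≠ 0 := fun h => by rw [h, mul_zero] at hd0; exact hd0.ne rfl
          rw [pow_mul 2 4, mul_add, pow_add (n * q)]
          norm_num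
          field_simp
  -- The ℓ⁴ norm is at most the ℓ² norm, so the numerator is at most (δ³)^(4N), against (δ⁴/2)^(4N)
  -- in the denominator.
  have hrem : ∑ i, ((centeredMat q x ^ N *ᵥ v) i / l ^ N) ^ 4 ≤ 16 ^ N / δ ^ (4 * N) := by
    have h1 := sum_pow_four_le_sq_sum_sq (centeredMat q x ^ N *ᵥ v)
    have h2 := hB.pow N v
    rw [(topVec_spec hn (adjMat_isSymm x)).1, mul_one] at h2
    have h3 : ∑ i, (centeredMat q x ^ N *ᵥ v) i ^ 4 ≤ δ ^ (12 * N) := by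
      refine h1.trans ((pow_le_pow_left₀ (dotProduct_self_nonneg' _) h2 2).trans_eq ?_)
      rw [← pow_mul, ← pow_mul, ← pow_mul]; congr 1; ring
    calc ∑ i, ((centeredMat q x ^ N *ᵥ v) i / l ^ N) ^ 4
        = (∑ i, (centeredMat q x ^ N *ᵥ v) i ^ 4) * (1 / l ^ (4 * N)) := by
          rw [Finset.sum_mul]
          refine Finset.sum_congr rfl fun i _ => ?_
          rw [div_pow, ← pow_mul, mul_comm N 4]; ring
      _ ≤ δ ^ (12 * N) * (2 ^ (4 * N) / (n * q) ^ (4 * N)) :=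
          mul_le_mul h3 (hinv _) (by positivity) (by positivity)
      _ = 16 ^ N / δ ^ (4 * N) := by
          rw [← hd, ← pow_mul, pow_mul 2 4]
          have : δ ^ (4 * (4 * N)) = δ ^ (12 * N) * δ ^ (4 * N) := by rw [← pow_add]; congr 1; ring
          rw [this]
          norm_num
          field_simp
  calc ∑ i, v i ^ 4
      ≤ ∑ i, 8 * ((N : ℝ) ^ 3 * ∑ k ∈ Finset.range N, 16 ^ (k + 1) /
          ((n : ℝ) ^ 2 * (n * q) ^ (4 * k)) * (centeredMat q x ^ k *ᵥ 1) i ^ 4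
          + ((centeredMat q x ^ N *ᵥ v) i / l ^ N) ^ 4) := by
        refine Finset.sum_le_sum fun i _ => ?_
        rw [hv, topVec_expansion hn q x hl0.ne' N i]
        refine (add_pow_four_le _ _).trans ?_
        refine mul_le_mul_of_nonneg_left (add_le_add_left ?_ _) (by norm_num)
        refine (sum_pow_four_le N _).trans ?_
        refine mul_le_mul_of_nonneg_left (Finset.sum_le_sum fun k _ => ?_) (by positivity)
        rw [mul_pow]
        exact mul_le_mul_of_nonneg_right (hcoef k) (by positivity)
    _ = 8 * ((N : ℝ) ^ 3 * ∑ k ∈ Finset.range N, 16 ^ (k + 1) /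
          ((n : ℝ) ^ 2 * (n * q) ^ (4 * k)) * ∑ i, (centeredMat q x ^ k *ᵥ 1) i ^ 4)
          + 8 * ∑ i, ((centeredMat q x ^ N *ᵥ v) i / l ^ N) ^ 4 := by
        rw [← Finset.mul_sum, Finset.sum_add_distrib, mul_add, ← Finset.mul_sum, Finset.sum_comm]
        simp only [Finset.mul_sum]
    _ ≤ _ := by
        have := mul_le_mul_of_nonneg_left hrem (show (0 : ℝ) ≤ 8 by norm_num)
        linarith

theorem dotProduct_centeredMat_le_sq_sum_abs {q : ℝ} (h0 : 0 ≤ q) (h1 : q ≤ 1) (x : Edge n → Bool)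
    (u : Fin n → ℝ) : u ⬝ᵥ centeredMat q x *ᵥ u ≤ (∑ i, |u i|) ^ 2 := by
  rw [dotProduct_mulVec_eq_sum, sq, Finset.sum_mul_sum]
  refine Finset.sum_le_sum fun i _ => Finset.sum_le_sum fun j _ => ?_
  refine (le_abs_self _).trans ?_
  rw [abs_mul, abs_mul]
  exact mul_le_of_le_one_left (by positivity) (abs_centeredMat_le h0 h1 x i j)

theorem quadratic_forms_le (hn : 0 < n) {q δ : ℝ} (h0 : 0 ≤ q) (h1 : q ≤ 1) (hδ : 2 ≤ δ)
    (hd : δ ^ 4 = n * q) (x : Edge n → Bool) (N m : ℕ) :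
    topVecSq x ⬝ᵥ centeredMat q x *ᵥ topVecSq x
      + 2 / n * (topVec (adjMat x) ⬝ᵥ centeredMat q x *ᵥ topVec (adjMat x)) ≤
    δ ^ 3 * (8 * ((N : ℝ) ^ 3 * ∑ k ∈ Finset.range N,
        16 ^ (k + 1) / ((n : ℝ) ^ 2 * (n * q) ^ (4 * k)) *
        ∑ i, (centeredMat q x ^ k *ᵥ 1) i ^ 4) + 8 * (16 ^ N / δ ^ (4 * N)))
      + 2 / n * δ ^ 3
      + 3 / (δ ^ 6) ^ (2 ^ m) * ∑ i, ∑ j, (centeredMat q x ^ (2 ^ m)) i j ^ 2 := by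
  have hn0 : (0 : ℝ) < n := by positivity
  have hδ0 : 0 < δ := by linarith
  have hS : 0 ≤ ∑ k ∈ Finset.range N,
        16 ^ (k + 1) / ((n : ℝ) ^ 2 * (n * q) ^ (4 * k)) *
        ∑ i, (centeredMat q x ^ k *ᵥ 1) i ^ 4 :=
    Finset.sum_nonneg fun k _ => mul_nonneg (by positivity)
      (Finset.sum_nonneg fun i _ => by positivity)
  have hT : 0 ≤ ∑ i, ∑ j, (centeredMat q x ^ (2 ^ m)) i j ^ 2 :=
    Finset.sum_nonneg fun i _ => Finset.sum_nonneg fun j _ => sq_nonneg _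
  -- On the good event ‖H‖ ≤ δ³ and delocalization applies.
  by_cases hG : ∑ i, ∑ j, (centeredMat q x ^ (2 ^ m)) i j ^ 2 ≤ ((δ ^ 3) ^ 2) ^ (2 ^ m)
  · have hB := opBound_of_frobenius_pow_le (centeredMat_isSymm q x) m hG
    have h4 := sum_topVec_pow_four_le hn hδ hd hB N
    have a1 := (abs_le.1 (hB.abs_dotProduct_le (by positivity) (topVecSq x))).2
    have a2 := (abs_le.1 (hB.abs_dotProduct_le (by positivity) (topVec (adjMat x)))).2
    rw [(topVec_spec hn (adjMat_isSymm x)).1, mul_one] at a2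
    have hw : topVecSq x ⬝ᵥ topVecSq x = ∑ i, topVec (adjMat x) i ^ 4 := by
      simp only [dotProduct, topVecSq]
      exact Finset.sum_congr rfl fun i _ => by ring
    rw [hw] at a1
    have b1 := a1.trans (mul_le_mul_of_nonneg_left h4 (by positivity))
    have b2 := mul_le_mul_of_nonneg_left a2 (show 0 ≤ 2 / (n : ℝ) by positivity)
    have b3 : 0 ≤ 3 / (δ ^ 6) ^ (2 ^ m) * ∑ i, ∑ j, (centeredMat q x ^ (2 ^ m)) i j ^ 2 :=
      mul_nonneg (by positivity) hT
    linarith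
  -- On the bad event the trivial bound 1 + 2 = 3 is used, and the Frobenius term is at least 3:
  -- Markov's inequality in pointwise form.
  · have c1 := dotProduct_centeredMat_le_sq_sum_abs h0 h1 x (topVecSq x)
    have c2 := dotProduct_centeredMat_le_sq_sum_abs h0 h1 x (topVec (adjMat x))
    have d1 : ∑ i, |topVecSq x i| = 1 := by
      rw [← sum_topVecSq hn x]
      exact Finset.sum_congr rfl fun i _ => abs_of_nonneg (sq_nonneg _)
    have d2 : (∑ i, |topVec (adjMat x) i|) ^ 2 ≤ n := by
      have h := sq_sum_le_card_mul_sum_sq (s := Finset.univ) (f := fun i => |topVec (adjMat x) i|)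
      have h2 := sum_topVecSq hn x
      simp only [topVecSq] at h2
      simp only [sq_abs] at h
      rw [h2] at h
      simpa using h
    rw [d1] at c1
    have e2 : 2 / (n : ℝ) * (topVec (adjMat x) ⬝ᵥ centeredMat q x *ᵥ topVec (adjMat x)) ≤ 2 := by
      calc _ ≤ 2 / (n : ℝ) * n := mul_le_mul_of_nonneg_left (c2.trans d2) (by positivity)
        _ = 2 := by field_simp
    have e3 : 3 ≤ 3 / (δ ^ 6) ^ (2 ^ m) * ∑ i, ∑ j, (centeredMat q x ^ (2 ^ m)) i j ^ 2 := by
      rw [div_mul_eq_mul_div, le_div_iff₀ (by positivity)]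
      have : (δ ^ 6) ^ (2 ^ m) = ((δ ^ 3) ^ 2) ^ (2 ^ m) := by ring
      rw [this]
      linarith
    have e4 : 0 ≤ δ ^ 3 * (8 * ((N : ℝ) ^ 3 * ∑ k ∈ Finset.range N,
        16 ^ (k + 1) / ((n : ℝ) ^ 2 * (n * q) ^ (4 * k)) *
        ∑ i, (centeredMat q x ^ k *ᵥ 1) i ^ 4) + 8 * (16 ^ N / δ ^ (4 * N))) := by positivity
    have e5 : 0 ≤ 2 / (n : ℝ) * δ ^ 3 := by positivity
    linarith

theorem cubeExp_sum_iterate_pow_four_le {q : ℝ} (h0 : 0 ≤ q) (h1 : q ≤ 1)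
    (hd : 1 ≤ n * q) (k : ℕ) :
    cubeExp q (fun x : Edge n → Bool => ∑ i, (centeredMat q x ^ k *ᵥ 1) i ^ 4) ≤
      n * ((1 + 4 * k : ℝ) ^ (4 * k) * (n * q) ^ (2 * k)) := by
  rw [cubeExp_sum]
  refine (Finset.sum_le_card_nsmul _ _ ((1 + 4 * k : ℝ) ^ (4 * k) * (n * q) ^ (2 * k))
    fun i _ => ?_).trans_eq (by simp)
  have h := cubeExp_centeredMat_pow_mulVec_le h0 h1 hd (u := 1) (by simp) k 2 i
  norm_num at h
  exact h

theorem cubeExp_frobenius_le {q : ℝ} (h0 : 0 ≤ q) (h1 : q ≤ 1)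
    (hd : 1 ≤ n * q) (k : ℕ) :
    cubeExp q (fun x : Edge n → Bool => ∑ i, ∑ j, (centeredMat q x ^ k) i j ^ 2) ≤
      (n : ℝ) ^ 2 * ((1 + 2 * k : ℝ) ^ (2 * k) * (n * q) ^ k) := by
  rw [cubeExp_sum]
  refine (Finset.sum_le_card_nsmul _ _ (n * ((1 + 2 * k : ℝ) ^ (2 * k) * (n * q) ^ k))
    fun i _ => ?_).trans_eq (by simp; ring)
  rw [cubeExp_sum]
  refine (Finset.sum_le_card_nsmul _ _ ((1 + 2 * k : ℝ) ^ (2 * k) * (n * q) ^ k)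
    fun j _ => ?_).trans_eq (by simp)
  have h := cubeExp_centeredMat_pow_mulVec_le h0 h1 hd (u := Pi.single j 1) (fun l => by
    by_cases hl : l = j
    · subst hl; simp
    · simp [hl]) k 1 i
  simpa using h

/-- The deviation of the largest eigenvalue from the mean degree has variance `o(q)`. -/
theorem exists_cubeVar_eigDev_le (N m : ℕ) :
    ∃ C : ℝ, ∀ {n : ℕ}, 0 < n → ∀ {q δ : ℝ}, 0 ≤ q → q ≤ 1 → 2 ≤ δ → δ ^ 4 = n * q →
      (n : ℝ) ≤ δ ^ (4 * N) → (n : ℝ) ^ 3 ≤ δ ^ (2 * 2 ^ m) →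
      cubeVar q (eigDev (n := n)) ≤ C * q / δ := by
  set B : ℝ := ∑ k ∈ Finset.range N, 16 ^ (k + 1) * (1 + 4 * k : ℝ) ^ (4 * k) with hBdef
  set Q : ℕ := 2 ^ m with hQ
  refine ⟨2 * (8 * ((N : ℝ) ^ 3 * B) + 8 * 16 ^ N + 2 + 3 * (1 + 2 * Q : ℝ) ^ (2 * Q)), ?_⟩
  intro n hn q δ h0 h1 hδ hd hN hm
  have hn0 : (0 : ℝ) < n := by positivity
  have hδ0 : 0 < δ := by linarith
  have hδ1 : 1 ≤ δ := by linarith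
  have hd1 : 1 ≤ n * q := by rw [← hd]; exact one_le_pow₀ hδ1
  have hq : q = δ ^ 4 / n := by rw [hd]; field_simp
  have hlin : cubeExp q (fun x : Edge n → Bool =>
      δ ^ 3 * (8 * ((N : ℝ) ^ 3 * ∑ k ∈ Finset.range N,
        16 ^ (k + 1) / ((n : ℝ) ^ 2 * (n * q) ^ (4 * k)) *
        ∑ i, (centeredMat q x ^ k *ᵥ 1) i ^ 4) + 8 * (16 ^ N / δ ^ (4 * N)))
      + 2 / n * δ ^ 3
      + 3 / (δ ^ 6) ^ Q * ∑ i, ∑ j, (centeredMat q x ^ Q) i j ^ 2)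
      = δ ^ 3 * (8 * ((N : ℝ) ^ 3 * ∑ k ∈ Finset.range N,
        16 ^ (k + 1) / ((n : ℝ) ^ 2 * (n * q) ^ (4 * k)) *
        cubeExp q (fun x : Edge n → Bool => ∑ i, (centeredMat q x ^ k *ᵥ 1) i ^ 4))
          + 8 * (16 ^ N / δ ^ (4 * N)))
      + 2 / n * δ ^ 3
      + 3 / (δ ^ 6) ^ Q *
        cubeExp q (fun x : Edge n → Bool => ∑ i, ∑ j, (centeredMat q x ^ Q) i j ^ 2) := by
    rw [cubeExp_add, cubeExp_add, cubeExp_const_mul, cubeExp_const_mul, cubeExp_const, cubeExp_add,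
      cubeExp_const_mul, cubeExp_const_mul, cubeExp_const, cubeExp_sum]
    simp only [cubeExp_const_mul]
  have hS : ∑ k ∈ Finset.range N, 16 ^ (k + 1) / ((n : ℝ) ^ 2 * (n * q) ^ (4 * k)) *
        cubeExp q (fun x : Edge n → Bool => ∑ i, (centeredMat q x ^ k *ᵥ 1) i ^ 4) ≤ B / n := by
    rw [hBdef, Finset.sum_div]
    refine Finset.sum_le_sum fun k _ => ?_
    -- The moment contributes d^(2k) against d^(4k) in the coefficient, so each k costs only O(1/n).
    have hdk : (1 : ℝ) ≤ (n * q) ^ (2 * k) := one_le_pow₀ hd1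
    calc _ ≤ 16 ^ (k + 1) / ((n : ℝ) ^ 2 * (n * q) ^ (4 * k)) *
          (n * ((1 + 4 * k : ℝ) ^ (4 * k) * (n * q) ^ (2 * k))) :=
          mul_le_mul_of_nonneg_left (cubeExp_sum_iterate_pow_four_le h0 h1 hd1 k) (by positivity)
      _ = 16 ^ (k + 1) * (1 + 4 * k : ℝ) ^ (4 * k) / n / (n * q) ^ (2 * k) := by
          have : (n * q) ^ (4 * k) = (n * q) ^ (2 * k) * (n * q) ^ (2 * k) := by
            rw [← pow_add]; congr 1; ring
          rw [this]
          have hne : (n * q) ^ (2 * k) ≠ 0 := by linarith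
          generalize (n * q) ^ (2 * k) = z at *
          field_simp
      _ ≤ _ := div_le_self (by positivity) hdk
  have hF := cubeExp_frobenius_le h0 h1 hd1 Q (n := n)
  have key := (cubeVar_eigDev_le hn h0 h1).trans (mul_le_mul_of_nonneg_left
    ((cubeExp_mono h0 h1 fun x => quadratic_forms_le hn h0 h1 hδ hd x N m).trans_eq hlin)
      zero_le_two)
  refine key.trans ?_
  have t1 : δ ^ 3 * (8 * ((N : ℝ) ^ 3 * ∑ k ∈ Finset.range N,
        16 ^ (k + 1) / ((n : ℝ) ^ 2 * (n * q) ^ (4 * k)) *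
        cubeExp q (fun x : Edge n → Bool => ∑ i, (centeredMat q x ^ k *ᵥ 1) i ^ 4))
          + 8 * (16 ^ N / δ ^ (4 * N))) ≤ (8 * ((N : ℝ) ^ 3 * B) + 8 * 16 ^ N) * (q / δ) := by
    have u1 : 16 ^ N / δ ^ (4 * N) ≤ (16 : ℝ) ^ N / n := by gcongr
    calc _ ≤ δ ^ 3 * (8 * ((N : ℝ) ^ 3 * (B / n)) + 8 * ((16 : ℝ) ^ N / n)) := by gcongr
      _ = _ := by rw [hq]; field_simp
  have t2 : 2 / n * δ ^ 3 = 2 * (q / δ) := by rw [hq]; field_simp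
  have t3 : 3 / (δ ^ 6) ^ Q *
        cubeExp q (fun x : Edge n → Bool => ∑ i, ∑ j, (centeredMat q x ^ Q) i j ^ 2)
      ≤ 3 * (1 + 2 * Q : ℝ) ^ (2 * Q) * (q / δ) := by
    -- The gain (d/δ⁶)^Q = δ^(-2Q) must absorb n³: n² from the Frobenius sum, and one more n to
    -- reach 1/n.
    have u1 : (n : ℝ) ^ 2 * (n * q) ^ Q / (δ ^ 6) ^ Q ≤ 1 / n := by
      rw [← hd, div_le_div_iff₀ (by positivity) hn0, one_mul]
      calc (n : ℝ) ^ 2 * (δ ^ 4) ^ Q * n = (n : ℝ) ^ 3 * (δ ^ 4) ^ Q := by ring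
        _ ≤ δ ^ (2 * Q) * (δ ^ 4) ^ Q := by gcongr
        _ = (δ ^ 6) ^ Q := by rw [← pow_mul, ← pow_mul, ← pow_add]; congr 1; ring
    have u2 : 1 / (n : ℝ) ≤ q / δ := by
      rw [hq]
      have : δ ^ 4 / n / δ = δ ^ 3 * (1 / n) := by field_simp
      rw [this]
      exact le_mul_of_one_le_left (by positivity) (one_le_pow₀ hδ1)
    calc _ ≤ 3 / (δ ^ 6) ^ Q * ((n : ℝ) ^ 2 * ((1 + 2 * Q : ℝ) ^ (2 * Q) * (n * q) ^ Q)) :=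
          mul_le_mul_of_nonneg_left hF (by positivity)
      _ = 3 * (1 + 2 * Q : ℝ) ^ (2 * Q) * ((n : ℝ) ^ 2 * (n * q) ^ Q / (δ ^ 6) ^ Q) := by ring
      _ ≤ _ := mul_le_mul_of_nonneg_left (u1.trans u2) (by positivity)
  rw [t2]
  have : ∀ a b c d : ℝ, 2 * (a + b + c + d) * q / δ = 2 * ((a + b) * (q / δ) + c * (q / δ)
    + d * (q / δ)) := fun a b c d => by ring
  rw [this]
  linarith

end Delocalization

/-! ### The law of a symmetric Bernoulli matrix -/

section Law

variable {Ω : Type*} [MeasurableSpace Ω] {P : Measure Ω} {n : ℕ} {q : unitInterval}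
  {A : Ω → Matrix (Fin n) (Fin n) ℝ}

open Classical in
/-- The independent entries of a matrix, as bits. -/
noncomputable def entryBits (M : Matrix (Fin n) (Fin n) ℝ) (e : Edge n) : Bool :=
  decide (M e.1.1 e.1.2 = 1)

namespace IsSymmetricBernoulliMatrix

theorem ae_eq_adjMat (hA : IsSymmetricBernoulliMatrix P q A) :
    ∀ᵐ ω ∂P, A ω = adjMat (entryBits (A ω)) := by
  have h01 : ∀ᵐ ω ∂P, ∀ e : Edge n, A ω e.1.1 e.1.2 = 0 ∨ A ω e.1.1 e.1.2 = 1 := by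
    rw [ae_all_iff]
    intro e
    have hlaw := hA.bernoulli e.1.1 e.1.2 e.2
    refine ae_of_ae_map (p := fun y => y = 0 ∨ y = 1) hlaw.aemeasurable ?_
    rw [hlaw.map_eq, ae_iff]
    refine bernoulliMeasure_apply_of_notMem_of_notMem q ?_ ?_ ?_
    · exact (((measurableSet_singleton 0).union (measurableSet_singleton 1)).compl :
        MeasurableSet ({0} ∪ {1} : Set ℝ)ᶜ)
    · simp
    · simp
  filter_upwards [h01] with ω hω
  ext i j
  have hsym : A ω i j = A ω (mkEdge i j).1.1 (mkEdge i j).1.2 := by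
    rcases le_total i j with h | h
    · simp [mkEdge, h]
    · simp [mkEdge, h, (hA.symm ω).apply j i]
  rw [hsym]
  rcases hω (mkEdge i j) with h | h <;> simp [adjMat, entryBits, h]

theorem aemeasurable_entryBits (hA : IsSymmetricBernoulliMatrix P q A) :
    AEMeasurable (fun ω => entryBits (A ω)) P := by
  classical
  rw [aemeasurable_pi_iff]
  intro e
  have hm : Measurable (fun z : ℝ => decide (z = 1)) :=
    measurable_to_bool (by
      convert measurableSet_singleton (1 : ℝ) using 1
      ext z; simp)
  have h := hm.comp_aemeasurable (hA.bernoulli e.1.1 e.1.2 e.2).aemeasurable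
  exact h.congr (ae_of_all _ fun ω => by simp [entryBits])

theorem map_entryBits_singleton [IsProbabilityMeasure P] (hA : IsSymmetricBernoulliMatrix P q A)
    (x : Edge n → Bool) :
    (P.map (fun ω => entryBits (A ω))).real {x} = cubeWeight (q : ℝ) x := by
  classical
  set s : Edge n → Set ℝ := fun e => if x e then {1} else {1}ᶜ with hs
  have hsm : ∀ e, MeasurableSet (s e) := by
    intro e
    simp only [hs]
    split_ifs
    · exact measurableSet_singleton _
    · exact (measurableSet_singleton _).compl
  rw [measureReal_def, Measure.map_apply_of_aemeasurable hA.aemeasurable_entryBits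
    (measurableSet_singleton x)]
  have hset : (fun ω => entryBits (A ω)) ⁻¹' {x}
      = ⋂ e ∈ (Finset.univ : Finset (Edge n)), (fun ω => A ω e.1.1 e.1.2) ⁻¹' (s e) := by
    ext ω
    simp only [Set.mem_preimage, Set.mem_singleton_iff, funext_iff, Set.mem_iInter,
      Finset.mem_univ, true_imp_iff]
    refine forall_congr' fun e => ?_
    simp only [hs, entryBits]
    cases x e <;> simp
  rw [hset, hA.indep.measure_inter_preimage_eq_mul Finset.univ (fun e _ => hsm e),
    ENNReal.toReal_prod]
  refine Finset.prod_congr rfl fun e _ => ?_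
  have hlaw := hA.bernoulli e.1.1 e.1.2 e.2
  rw [← Measure.map_apply_of_aemeasurable hlaw.aemeasurable (hsm e), hlaw.map_eq,
    ← measureReal_def, bernoulliMeasure_real_apply q (hsm e)]
  simp only [hs, bernoulliWeight]
  cases x e <;> simp

variable {E : Type*} [NormedAddCommGroup E]

/-- Almost surely A is a function of a point of a finite cube, so no measurability of F is needed.
-/
theorem integrable_comp [IsProbabilityMeasure P] (hA : IsSymmetricBernoulliMatrix P q A)
    (F : Matrix (Fin n) (Fin n) ℝ → E) : Integrable (fun ω => F (A ω)) P := by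
  have : IsProbabilityMeasure (P.map (fun ω => entryBits (A ω))) :=
    Measure.isProbabilityMeasure_map hA.aemeasurable_entryBits
  have h : Integrable (fun x => F (adjMat x)) (P.map (fun ω => entryBits (A ω))) :=
    Integrable.of_finite
  refine (h.comp_aemeasurable hA.aemeasurable_entryBits).congr ?_
  filter_upwards [hA.ae_eq_adjMat] with ω hω
  simp only [Function.comp_apply]
  rw [← hω]

theorem integral_comp [IsProbabilityMeasure P] [NormedSpace ℝ E] [CompleteSpace E]
    (hA : IsSymmetricBernoulliMatrix P q A) (F : Matrix (Fin n) (Fin n) ℝ → E) :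
    ∫ ω, F (A ω) ∂P = ∑ x, cubeWeight (q : ℝ) x • F (adjMat x) := by
  have : IsProbabilityMeasure (P.map (fun ω => entryBits (A ω))) :=
    Measure.isProbabilityMeasure_map hA.aemeasurable_entryBits
  have h : Integrable (fun x => F (adjMat x)) (P.map (fun ω => entryBits (A ω))) :=
    Integrable.of_finite
  have h1 : ∫ ω, F (A ω) ∂P = ∫ ω, F (adjMat (entryBits (A ω))) ∂P := by
    refine integral_congr_ae ?_
    filter_upwards [hA.ae_eq_adjMat] with ω hω
    rw [← hω]
  rw [h1, ← integral_map (f := fun x => F (adjMat x)) hA.aemeasurable_entryBits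
    h.aestronglyMeasurable, integral_fintype h]
  simp only [hA.map_entryBits_singleton]

end IsSymmetricBernoulliMatrix

end Law

/-! ### The characteristic function of the mean degree -/

section CharFun

open Complex

theorem norm_prod_sub_prod_le {ι : Type*} (s : Finset ι) {a b : ι → ℂ}
    (ha : ∀ i, ‖a i‖ ≤ 1) (hb : ∀ i, ‖b i‖ ≤ 1) :
    ‖∏ i ∈ s, a i - ∏ i ∈ s, b i‖ ≤ ∑ i ∈ s, ‖a i - b i‖ := by
  classical
  induction s using Finset.induction_on with
  | empty => simp
  | insert i s hi ih =>
    rw [Finset.prod_insert hi, Finset.prod_insert hi, Finset.sum_insert hi]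
    have hp : ‖∏ j ∈ s, b j‖ ≤ 1 := by
      rw [norm_prod]; exact Finset.prod_le_one (fun _ _ => norm_nonneg _) fun j _ => hb j
    calc ‖a i * ∏ j ∈ s, a j - b i * ∏ j ∈ s, b j‖
        = ‖(a i - b i) * ∏ j ∈ s, b j + a i * (∏ j ∈ s, a j - ∏ j ∈ s, b j)‖ := by
          congr 1; ring
      _ ≤ ‖a i - b i‖ * ‖∏ j ∈ s, b j‖ + ‖a i‖ * ‖∏ j ∈ s, a j - ∏ j ∈ s, b j‖ := by
          refine (norm_add_le _ _).trans ?_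
          rw [norm_mul, norm_mul]
      _ ≤ ‖a i - b i‖ * 1 + 1 * ∑ j ∈ s, ‖a j - b j‖ := by
          gcongr
          exact ha i
      _ = _ := by ring

theorem norm_ofReal_of_nonneg {r : ℝ} (hr : 0 ≤ r) : ‖(r : ℂ)‖ = r := by
  rw [norm_real, Real.norm_of_nonneg hr]

/-- The characteristic function of a centered Bernoulli variable. -/
noncomputable def bitCharFun (q θ : ℝ) : ℂ :=
  q * exp (θ * (1 - q) * I) + (1 - q) * exp (θ * (-q) * I)

theorem norm_bitCharFun_le {q : ℝ} (h0 : 0 ≤ q) (h1 : q ≤ 1) (θ : ℝ) : ‖bitCharFun q θ‖ ≤ 1 := by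
  have e1 : ‖exp (θ * (1 - q) * I)‖ = 1 := by
    have := norm_exp_ofReal_mul_I (θ * (1 - q)); push_cast at this; exact this
  have e2 : ‖exp (θ * (-q) * I)‖ = 1 := by
    have := norm_exp_ofReal_mul_I (θ * (-q)); push_cast at this; exact this
  refine (norm_add_le _ _).trans ?_
  rw [norm_mul, norm_mul, e1, e2]
  have e3 : ‖(1 - q : ℂ)‖ = 1 - q := by
    have := norm_ofReal_of_nonneg (show 0 ≤ 1 - q by linarith); push_cast at this; exact this
  rw [e3, norm_ofReal_of_nonneg h0]
  linarith

theorem norm_exp_mul_I_sub_le {y : ℝ} (hy : |y| ≤ 1) :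
    ‖exp (y * I) - (1 + y * I - (y : ℂ) ^ 2 / 2)‖ ≤ |y| ^ 3 := by
  have hn : ‖(y * I : ℂ)‖ = |y| := by simp
  have h := Complex.exp_bound (x := y * I) (by rw [hn]; exact hy) (n := 3) (by norm_num)
  rw [hn] at h
  have hs : ∑ m ∈ Finset.range 3, (y * I : ℂ) ^ m / (m.factorial : ℂ)
      = 1 + y * I - (y : ℂ) ^ 2 / 2 := by
    simp [Finset.sum_range_succ, mul_pow]; ring
  rw [hs] at h
  refine h.trans ?_
  refine mul_le_of_le_one_right (by positivity) ?_
  norm_num [Nat.factorial]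

/-- Both functions agree to second order. The error must carry the factor q(1-q), and not only |θ|³,
because q may tend to zero while about n² such errors are added. -/
theorem norm_bitCharFun_sub_le {q θ : ℝ} (h0 : 0 ≤ q) (h1 : q ≤ 1) (hθ : |θ| ≤ 1) :
    ‖bitCharFun q θ - exp ((-(θ ^ 2 * (q * (1 - q)) / 2) : ℝ) : ℂ)‖
      ≤ 2 * (|θ| ^ 3 * (q * (1 - q))) := by
  have h1' : 0 ≤ 1 - q := by linarith
  have hv : 0 ≤ q * (1 - q) := mul_nonneg h0 h1'
  have hv1 : q * (1 - q) ≤ 1 := by nlinarith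
  have y1 : |θ * (1 - q)| = |θ| * (1 - q) := by rw [abs_mul, abs_of_nonneg h1']
  have y2 : |θ * (-q)| = |θ| * q := by rw [abs_mul, abs_neg, abs_of_nonneg h0]
  have hθ0 := abs_nonneg θ
  have b1 := norm_exp_mul_I_sub_le (y := θ * (1 - q)) (by rw [y1]; nlinarith)
  have b2 := norm_exp_mul_I_sub_le (y := θ * (-q)) (by rw [y2]; nlinarith)
  rw [y1] at b1
  rw [y2] at b2
  push_cast at b1 b2
  set E1 := exp (θ * (1 - q) * I) - (1 + θ * (1 - q) * I - (θ * (1 - q) : ℂ) ^ 2 / 2) with hE1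
  set E2 := exp (θ * (-q) * I) - (1 + θ * (-q) * I - (θ * (-q) : ℂ) ^ 2 / 2) with hE2
  set w : ℝ := θ ^ 2 * (q * (1 - q)) / 2 with hw
  have hw0 : 0 ≤ w := by positivity
  have hθ2 : θ ^ 2 = |θ| ^ 2 := (sq_abs θ).symm
  have hθ21 : |θ| ^ 2 ≤ 1 := pow_le_one₀ hθ0 hθ
  have hw1 : w ≤ 1 := by rw [hw, hθ2]; nlinarith
  have b3 : ‖exp ((-w : ℝ) : ℂ) - (1 - w)‖ ≤ w ^ 2 := by
    have h := Real.abs_exp_sub_one_sub_id_le (x := -w)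
      (by rw [abs_neg, abs_of_nonneg hw0]; exact hw1)
    rw [neg_sq] at h
    have e : exp ((-w : ℝ) : ℂ) - (1 - w) = ((Real.exp (-w) - 1 - -w : ℝ) : ℂ) := by
      push_cast; ring
    rw [e, norm_real]; exact h
  have hdec : bitCharFun q θ - exp ((-w : ℝ) : ℂ)
      = (q * E1 + (1 - q) * E2) - (exp ((-w : ℝ) : ℂ) - (1 - w)) := by
    rw [bitCharFun, hE1, hE2, hw]; push_cast; ring
  rw [hdec]
  have e3 : ‖(1 - q : ℂ)‖ = 1 - q := by
    have := norm_ofReal_of_nonneg h1'; push_cast at this; exact this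
  have hT := pow_nonneg hθ0 3
  have c1 : ‖(q * E1 + (1 - q) * E2 : ℂ)‖ ≤ |θ| ^ 3 * (q * (1 - q)) := by
    calc _ ≤ q * ‖E1‖ + (1 - q) * ‖E2‖ := by
          refine (norm_add_le _ _).trans ?_
          rw [norm_mul, norm_mul, e3, norm_ofReal_of_nonneg h0]
      _ ≤ q * (|θ| * (1 - q)) ^ 3 + (1 - q) * (|θ| * q) ^ 3 := by gcongr
      _ = |θ| ^ 3 * (q * (1 - q)) * ((1 - q) ^ 2 + q ^ 2) := by ring
      _ ≤ |θ| ^ 3 * (q * (1 - q)) * 1 := by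
          refine mul_le_mul_of_nonneg_left (by nlinarith) (mul_nonneg hT hv)
      _ = _ := mul_one _
  have c2 : w ^ 2 ≤ |θ| ^ 3 * (q * (1 - q)) := by
    have : w ^ 2 = |θ| ^ 3 * (q * (1 - q)) * (|θ| * (q * (1 - q)) / 4) := by
      rw [hw, hθ2]; ring
    rw [this]
    refine mul_le_of_le_one_right (mul_nonneg hT hv) ?_
    nlinarith
  calc _ ≤ ‖(q * E1 + (1 - q) * E2 : ℂ)‖ + ‖exp ((-w : ℝ) : ℂ) - (1 - w)‖ := norm_sub_le _ _
    _ ≤ _ := by linarith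

/-! ### The mean degree as a weighted sum of independent bits -/

variable {n : ℕ}

theorem meanDegree_sub_eq (hn : 0 < n) (q : ℝ) (x : Edge n → Bool) :
    meanDegree x - n * q = ∑ e : Edge n, edgeMult e / n * centeredBit q (x e) := by
  have hn0 : (0 : ℝ) < n := by positivity
  have h := sum_sum_symm_eq_sum_edge (F := fun i j => centeredMat q x i j / n)
    (fun i j => by rw [(centeredMat_isSymm q x).apply])
  have h2 : ∑ i, ∑ j, centeredMat q x i j / n = meanDegree x - n * q := by
    simp only [centeredMat, Matrix.of_apply, sub_div, Finset.sum_sub_distrib, meanDegree,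
      Finset.sum_div, Finset.sum_const, Finset.card_univ, Fintype.card_fin, nsmul_eq_mul]
    field_simp
  rw [← h2, h]
  refine Finset.sum_congr rfl fun e _ => ?_
  rw [centeredMat_apply_eq, mkEdge_self]; ring

theorem sum_edgeMult_sq : ∑ e : Edge n, edgeMult e ^ 2 = 2 * (n : ℝ) ^ 2 - n := by
  have h := sum_sum_symm_eq_sum_edge (n := n) (F := fun i j => if i = j then (1 : ℝ) else 2)
    (fun i j => by simp [eq_comm])
  have h2 : ∑ i : Fin n, ∑ j : Fin n, (if i = j then (1 : ℝ) else 2) = 2 * (n : ℝ) ^ 2 - n := by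
    have : ∀ i j : Fin n, (if i = j then (1 : ℝ) else 2) = 2 - if i = j then 1 else 0 := by
      intro i j; split_ifs <;> norm_num
    simp only [this, Finset.sum_sub_distrib]
    simp; ring
  rw [← h2, h]
  exact Finset.sum_congr rfl fun e _ => by rw [sq]; rfl

theorem sum_cubeWeight_exp_meanDegree (hn : 0 < n) (q s : ℝ) :
    ∑ x : Edge n → Bool, (cubeWeight q x : ℂ) * exp (((s * (meanDegree x - n * q) : ℝ) : ℂ) * I)
      = ∏ e : Edge n, bitCharFun q (s * (edgeMult e / n)) := by
  have h := sum_prod_bool (ι := Edge n) (fun e b => (bernoulliWeight q b : ℂ) *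
    exp (((s * (edgeMult e / n) * centeredBit q b : ℝ) : ℂ) * I))
  refine Eq.trans (Fintype.sum_congr _ _ fun x => ?_) (h.trans ?_)
  · rw [Finset.prod_mul_distrib, ← exp_sum, cubeWeight, meanDegree_sub_eq hn, ← Finset.sum_mul,
      Finset.mul_sum]
    push_cast
    congr 4
    funext e
    ring
  · refine Finset.prod_congr rfl fun e _ => ?_
    simp [bernoulliWeight, bitCharFun, centeredBit]

theorem norm_charFun_meanDegree_sub_le (hn : 0 < n) {q : ℝ} (h0 : 0 < q) (h1 : q < 1) (t : ℝ)
    {c : ℝ} (hc : 0 ≤ c) (hcq : c ^ 2 * (q * (1 - q)) = 1) (hct : 2 * |t| * (c / n) ≤ 1) :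
    ‖(∑ x : Edge n → Bool, (cubeWeight q x : ℂ) *
        exp (((t * c * (meanDegree x - n * q) : ℝ) : ℂ) * I))
      - exp ((-(t ^ 2 - t ^ 2 / (2 * n)) : ℝ) : ℂ)‖ ≤ 8 * |t| ^ 3 * (c / n) := by
  have hn0 : (0 : ℝ) < n := by positivity
  have hv : 0 < q * (1 - q) := mul_pos h0 (by linarith)
  rw [sum_cubeWeight_exp_meanDegree hn]
  set θ : Edge n → ℝ := fun e => t * c * (edgeMult e / n) with hθ
  have habs : ∀ e, |θ e| = |t| * (c / n) * edgeMult e := by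
    intro e
    rw [hθ]
    simp only [abs_mul, abs_div, abs_of_nonneg hc, abs_of_nonneg (edgeMult_nonneg e),
      abs_of_pos hn0]
    ring
  have hm2 : ∀ e : Edge n, edgeMult e ≤ 2 := by
    intro e; unfold edgeMult; split_ifs <;> norm_num
  -- The Gaussian exponent is (t²/(2n²)) ∑ `edgeMult e`² = (t²/(2n²))(2n² - n), hence the correction
  -- t²/(2n).
  have hexp : exp ((-(t ^ 2 - t ^ 2 / (2 * n)) : ℝ) : ℂ)
      = ∏ e : Edge n, exp ((-(θ e ^ 2 * (q * (1 - q)) / 2) : ℝ) : ℂ) := by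
    rw [← exp_sum, ← ofReal_sum]
    congr 2
    have : ∀ e : Edge n, -(θ e ^ 2 * (q * (1 - q)) / 2)
        = -(t ^ 2 / (2 * n ^ 2)) * edgeMult e ^ 2 := by
      intro e
      calc -(θ e ^ 2 * (q * (1 - q)) / 2)
          = -(t ^ 2 / (2 * n ^ 2)) * edgeMult e ^ 2 * (c ^ 2 * (q * (1 - q))) := by
            rw [hθ]; field_simp
        _ = _ := by rw [hcq, mul_one]
    simp only [this]
    rw [← Finset.mul_sum, sum_edgeMult_sq]
    field_simp
  rw [hexp]
  refine (norm_prod_sub_prod_le _ (fun e => norm_bitCharFun_le h0.le h1.le _) fun e => ?_).trans ?_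
  · rw [← ofReal_exp, norm_real, Real.norm_of_nonneg (Real.exp_pos _).le]
    exact Real.exp_le_one_iff.2 (neg_nonpos.2 (by positivity))
  · have hterm : ∀ e : Edge n, ‖bitCharFun q (θ e) - exp ((-(θ e ^ 2 * (q * (1 - q)) / 2) : ℝ) : ℂ)‖
        ≤ 4 * |t| ^ 3 * (c / n) * (1 / n ^ 2) * edgeMult e ^ 2 := by
      intro e
      have hb : |θ e| ≤ 1 := by
        rw [habs]
        refine le_trans ?_ hct
        calc |t| * (c / n) * edgeMult e ≤ |t| * (c / n) * 2 := by gcongr; exact hm2 e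
          _ = _ := by ring
      refine (norm_bitCharFun_sub_le h0.le h1.le hb).trans ?_
      rw [habs]
      calc 2 * ((|t| * (c / n) * edgeMult e) ^ 3 * (q * (1 - q)))
          = 2 * |t| ^ 3 * (c / n) * (1 / n ^ 2) * edgeMult e ^ 2 * edgeMult e
              * (c ^ 2 * (q * (1 - q))) := by field_simp
        _ = 2 * |t| ^ 3 * (c / n) * (1 / n ^ 2) * edgeMult e ^ 2 * edgeMult e := by
            rw [hcq, mul_one]
        _ ≤ 2 * |t| ^ 3 * (c / n) * (1 / n ^ 2) * edgeMult e ^ 2 * 2 := by gcongr; exact hm2 e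
        _ = _ := by ring
    refine (Finset.sum_le_sum fun e _ => hterm e).trans ?_
    rw [← Finset.mul_sum, sum_edgeMult_sq]
    calc 4 * |t| ^ 3 * (c / n) * (1 / n ^ 2) * (2 * (n : ℝ) ^ 2 - n)
        ≤ 4 * |t| ^ 3 * (c / n) * (1 / n ^ 2) * (2 * (n : ℝ) ^ 2) := by
          gcongr; linarith
      _ = _ := by field_simp; ring

/-! ### From the mean degree to the largest eigenvalue -/

theorem norm_exp_mul_I_sub_exp_mul_I_le (a b : ℝ) : ‖exp (a * I) - exp (b * I)‖ ≤ |a - b| := by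
  have h : exp (a * I) - exp (b * I) = exp (b * I) * (exp (I * ((a - b : ℝ) : ℂ)) - 1) := by
    rw [mul_sub, ← exp_add, mul_one]; congr 2; push_cast; ring
  rw [h, norm_mul, norm_exp_ofReal_mul_I, one_mul]
  exact Real.norm_exp_I_mul_ofReal_sub_one_le

/-- Since y ↦ exp(iy) is 1-Lipschitz, the difference is at most |t| c E|D - E D|, and Cauchy–Schwarz
gives the standard deviation. -/
theorem norm_charFun_eigenvalue_sub_meanDegree_le (hn : 0 < n) {q : ℝ} (h0 : 0 ≤ q) (h1 : q ≤ 1)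
    (t : ℝ) {c : ℝ} (hc : 0 ≤ c) :
    ‖(∑ x : Edge n → Bool, (cubeWeight q x : ℂ) * exp (((t * c * (largestEigenvalue (adjMat x)
        - cubeExp q (fun x : Edge n → Bool => largestEigenvalue (adjMat x))) : ℝ) : ℂ) * I))
      - ∑ x : Edge n → Bool, (cubeWeight q x : ℂ) *
        exp (((t * c * (meanDegree x - n * q) : ℝ) : ℂ) * I)‖
      ≤ |t| * √(c ^ 2 * cubeVar q (eigDev (n := n))) := by
  rw [← Finset.sum_sub_distrib]
  set m := cubeExp q (fun x : Edge n → Bool => largestEigenvalue (adjMat x)) with hm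
  have hE : cubeExp q (eigDev (n := n)) = m - n * q := by
    have : (eigDev (n := n)) = fun x => largestEigenvalue (adjMat x) - meanDegree x := rfl
    rw [this, cubeExp_sub, ← cubeExp_meanDegree hn q]
  have hfun : ∀ x : Edge n → Bool, eigDev x - cubeExp q (eigDev (n := n))
      = (largestEigenvalue (adjMat x) - m) - (meanDegree x - n * q) := by
    intro x; rw [hE, eigDev]; ring
  have habs : cubeExp q (fun x : Edge n → Bool => |eigDev x - cubeExp q (eigDev (n := n))|)
      ≤ √(cubeVar q (eigDev (n := n))) := by
    refine Real.le_sqrt_of_sq_le ((sq_cubeExp_le h0 h1 _).trans_eq ?_)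
    simp only [sq_abs]
    rfl
  calc _ ≤ ∑ x : Edge n → Bool, cubeWeight q x *
        (|t| * c * |eigDev x - cubeExp q (eigDev (n := n))|) := by
        refine (norm_sum_le _ _).trans (Finset.sum_le_sum fun x _ => ?_)
        rw [← mul_sub, norm_mul, norm_ofReal_of_nonneg (cubeWeight_nonneg h0 h1 x)]
        refine mul_le_mul_of_nonneg_left ?_ (cubeWeight_nonneg h0 h1 x)
        refine (norm_exp_mul_I_sub_exp_mul_I_le _ _).trans_eq ?_
        rw [hfun, ← mul_sub, abs_mul, abs_mul, abs_of_nonneg hc]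
    _ = |t| * c * cubeExp q (fun x : Edge n → Bool =>
          |eigDev x - cubeExp q (eigDev (n := n))|) := by
        rw [← cubeExp_const_mul]; rfl
    _ ≤ |t| * c * √(cubeVar q (eigDev (n := n))) := by gcongr
    _ = _ := by rw [Real.sqrt_mul (sq_nonneg c), Real.sqrt_sq hc]; ring

end CharFun

/-! ### The central limit theorem -/

section Limit

open Topology

theorem tendsto_charFun_largestEigenvalue {p : ℕ → ℝ} {ε : ℝ} (hε : 0 < ε)
    (hp0 : ∀ n, 0 ≤ p n)
    (hp : ∀ᶠ n : ℕ in atTop, (n : ℝ) ^ (ε - 1) ≤ p n ∧ p n ≤ 1 / 2) (t : ℝ) :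
    Tendsto (fun n : ℕ => ∑ x : Edge n → Bool, (cubeWeight (p n) x : ℂ) *
        Complex.exp (((t * (1 / √(p n * (1 - p n))) * (largestEigenvalue (adjMat x)
        - cubeExp (p n) (fun x : Edge n → Bool => largestEigenvalue (adjMat x))) : ℝ) : ℂ)
          * Complex.I))
      atTop (𝓝 (Complex.exp ((-t ^ 2 : ℝ) : ℂ))) := by
  -- With δ = d^(1/4), the norm bound δ³ lies strictly between the typical size √d of ‖H‖ and the
  -- size d of λ₁, with integer powers throughout.
  set δ : ℕ → ℝ := fun n => (n * p n) ^ (1 / 4 : ℝ) with hδdef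
  -- As δ ≥ n^(ε/4), N ≥ 1/ε gives n ≤ δ^(4N), and 2^m > 6/ε gives n³ ≤ δ^(2·2^m).
  obtain ⟨N, hN⟩ := exists_nat_ge (1 / ε)
  obtain ⟨m, hm⟩ := pow_unbounded_of_one_lt (6 / ε) (one_lt_two (α := ℝ))
  obtain ⟨C, hC⟩ := exists_cubeVar_eigDev_le N m
  have hδge : ∀ᶠ n : ℕ in atTop, (n : ℝ) ^ (ε / 4) ≤ δ n := by
    filter_upwards [hp, eventually_gt_atTop 0] with n hn hn0
    have hn0' : (0 : ℝ) < n := by exact_mod_cast hn0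
    have h1 : (n : ℝ) ^ ε ≤ n * p n := by
      calc (n : ℝ) ^ ε = n * (n : ℝ) ^ (ε - 1) := by
            rw [Real.rpow_sub_one hn0'.ne']; field_simp
        _ ≤ _ := mul_le_mul_of_nonneg_left hn.1 hn0'.le
    calc (n : ℝ) ^ (ε / 4) = ((n : ℝ) ^ ε) ^ (1 / 4 : ℝ) := by
          rw [← Real.rpow_mul hn0'.le]; congr 1; ring
      _ ≤ _ := Real.rpow_le_rpow (by positivity) h1 (by norm_num)
  have hδtop : Tendsto δ atTop atTop :=
    tendsto_atTop_mono' _ hδge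
      ((tendsto_rpow_atTop (by positivity)).comp tendsto_natCast_atTop_atTop)
  have hδ4 : ∀ n, δ n ^ 4 = n * p n := by
    intro n
    have h : 0 ≤ n * p n := mul_nonneg (Nat.cast_nonneg n) (hp0 n)
    rw [hδdef]
    simp only
    rw [← Real.rpow_natCast, ← Real.rpow_mul h]
    norm_num
  have hpowge : ∀ (a k : ℕ), (a : ℝ) ≤ ε / 4 * k → ∀ᶠ n : ℕ in atTop, (n : ℝ) ^ a ≤ δ n ^ k := by
    intro a k hak
    filter_upwards [hδge, eventually_ge_atTop 1] with n hn hn1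
    have hn1' : (1 : ℝ) ≤ n := by exact_mod_cast hn1
    calc (n : ℝ) ^ a = (n : ℝ) ^ (a : ℝ) := (Real.rpow_natCast _ _).symm
      _ ≤ (n : ℝ) ^ (ε / 4 * k) := Real.rpow_le_rpow_of_exponent_le hn1' hak
      _ = ((n : ℝ) ^ (ε / 4)) ^ k := Real.rpow_mul_natCast (by linarith) _ _
      _ ≤ _ := pow_le_pow_left₀ (by positivity) hn k
  have hA : ∀ᶠ n : ℕ in atTop, (n : ℝ) ^ 1 ≤ δ n ^ (4 * N) := by
    refine hpowge _ _ ?_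
    rw [div_le_iff₀ hε] at hN
    push_cast; nlinarith
  have hB : ∀ᶠ n : ℕ in atTop, (n : ℝ) ^ 3 ≤ δ n ^ (2 * 2 ^ m) := by
    refine hpowge _ _ ?_
    rw [div_lt_iff₀ hε] at hm
    push_cast; nlinarith
  have hbound : ∀ᶠ n : ℕ in atTop, ‖(∑ x : Edge n → Bool, (cubeWeight (p n) x : ℂ) *
        Complex.exp (((t * (1 / √(p n * (1 - p n))) * (largestEigenvalue (adjMat x)
        - cubeExp (p n) (fun x : Edge n → Bool => largestEigenvalue (adjMat x))) : ℝ) : ℂ)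
          * Complex.I)) - Complex.exp ((-(t ^ 2 - t ^ 2 / (2 * n)) : ℝ) : ℂ)‖
      ≤ |t| * √(2 * C / δ n) + 8 * |t| ^ 3 * (1 / δ n) := by
    filter_upwards [hp, eventually_gt_atTop 0, hA, hB, hδtop.eventually_ge_atTop 2,
      hδtop.eventually_ge_atTop (2 * |t|)] with n hn hn0 hAn hBn hδ2 hδt
    have hn0' : (0 : ℝ) < n := by exact_mod_cast hn0
    have hn1' : (1 : ℝ) ≤ n := by exact_mod_cast hn0
    have hδ0 : 0 < δ n := by linarith
    have hq0 : 0 < p n := lt_of_lt_of_le (by positivity) hn.1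
    have hq1 : p n < 1 := by linarith [hn.2]
    have hv : 0 < p n * (1 - p n) := mul_pos hq0 (by linarith)
    have hv2 : p n / 2 ≤ p n * (1 - p n) := by nlinarith [hn.2]
    set c := 1 / √(p n * (1 - p n)) with hc
    have hc0 : 0 ≤ c := by positivity
    have hc2 : c ^ 2 = 1 / (p n * (1 - p n)) := by rw [hc, div_pow, Real.sq_sqrt hv.le, one_pow]
    have hcq : c ^ 2 * (p n * (1 - p n)) = 1 := by
      rw [hc2, one_div_mul_cancel hv.ne']
    have hcn : c / n ≤ 1 / δ n := by
      have h1 : δ n ≤ n * √(p n * (1 - p n)) := by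
        refine le_of_pow_le_pow_left₀ two_ne_zero (by positivity) ?_
        rw [mul_pow, Real.sq_sqrt hv.le]
        calc δ n ^ 2 ≤ δ n ^ 4 / 2 := by
              nlinarith [sq_nonneg (δ n), pow_le_pow_left₀ zero_le_two hδ2 2]
          _ = n * (p n / 2) := by rw [hδ4]; ring
          _ ≤ n * (p n * (1 - p n)) := mul_le_mul_of_nonneg_left hv2 hn0'.le
          _ ≤ (n : ℝ) ^ 2 * (p n * (1 - p n)) := by
              refine mul_le_mul_of_nonneg_right ?_ hv.le
              nlinarith
      rw [hc, div_div, mul_comm]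
      exact one_div_le_one_div_of_le hδ0 h1
    have hct : 2 * |t| * (c / n) ≤ 1 := by
      calc 2 * |t| * (c / n) ≤ δ n * (1 / δ n) :=
            mul_le_mul hδt hcn (by positivity) hδ0.le
        _ = 1 := by field_simp
    have hvar := hC hn0 hq0.le hq1.le hδ2 (hδ4 n) (by simpa using hAn) hBn
    have hvar2 : c ^ 2 * cubeVar (p n) (eigDev (n := n)) ≤ 2 * C / δ n := by
      -- The sign of C is not given; it is recovered from the variance being nonnegative.
      have hC0 : 0 ≤ C * p n / δ n := le_trans (by
        exact cubeExp_nonneg hq0.le hq1.le fun x => sq_nonneg _) hvar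
      have hc3 : c ^ 2 ≤ 2 / p n := by
        rw [hc2, div_le_div_iff₀ hv hq0]; linarith
      calc c ^ 2 * cubeVar (p n) (eigDev (n := n)) ≤ c ^ 2 * (C * p n / δ n) := by gcongr
        _ ≤ 2 / p n * (C * p n / δ n) := mul_le_mul_of_nonneg_right hc3 hC0
        _ = _ := by field_simp
    have e1 := norm_charFun_eigenvalue_sub_meanDegree_le hn0 hq0.le hq1.le t hc0
    have e2 := norm_charFun_meanDegree_sub_le hn0 hq0 hq1 t hc0 hcq hct
    refine (norm_sub_le_norm_sub_add_norm_sub _ _ _).trans (add_le_add (e1.trans ?_) (e2.trans ?_))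
    · exact mul_le_mul_of_nonneg_left (Real.sqrt_le_sqrt hvar2) (abs_nonneg t)
    · exact mul_le_mul_of_nonneg_left hcn (by positivity)
  have hinv : Tendsto (fun n => 1 / δ n) atTop (𝓝 0) := by
    simp only [one_div]
    exact hδtop.inv_tendsto_atTop
  have hlim0 : Tendsto (fun n => |t| * √(2 * C / δ n) + 8 * |t| ^ 3 * (1 / δ n)) atTop (𝓝 0) := by
    have h1 : Tendsto (fun n => √(2 * C / δ n)) atTop (𝓝 0) := by
      have h := (hinv.const_mul (2 * C)).sqrt
      simpa [div_eq_mul_inv] using h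
    simpa using (h1.const_mul |t|).add (hinv.const_mul (8 * |t| ^ 3))
  have hlimg : Tendsto (fun n : ℕ => Complex.exp ((-(t ^ 2 - t ^ 2 / (2 * n)) : ℝ) : ℂ)) atTop
      (𝓝 (Complex.exp ((-t ^ 2 : ℝ) : ℂ))) := by
    have h1 : Tendsto (fun n : ℕ => -(t ^ 2 - t ^ 2 / (2 * (n : ℝ)))) atTop (𝓝 (-t ^ 2)) := by
      have h2 := (tendsto_const_div_atTop_nhds_zero_nat (t ^ 2 / 2))
      have h3 := (tendsto_const_nhds (x := t ^ 2)).sub h2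
      rw [sub_zero] at h3
      refine h3.neg.congr fun n => ?_
      rw [div_div]
    exact ((Complex.continuous_exp.comp Complex.continuous_ofReal).tendsto _).comp h1
  have hdiff := squeeze_zero_norm' hbound hlim0
  simpa using hdiff.add hlimg

end Limit

theorem theorem2 {Ω : ℕ → Type*} [∀ n, MeasurableSpace (Ω n)]
    (P : ∀ n, Measure (Ω n)) [∀ n, IsProbabilityMeasure (P n)]
    (p : ℕ → unitInterval) (A : ∀ n, Ω n → Matrix (Fin n) (Fin n) ℝ)
    (hA : ∀ n, IsSymmetricBernoulliMatrix (P n) (p n) (A n))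
    (ε₀ : ℝ) (hε₀ : ε₀ ∈ Set.Ioo (0 : ℝ) 1)
    (hp : ∀ᶠ n : ℕ in atTop, (n : ℝ) ^ (ε₀ - 1) ≤ (p n : ℝ) ∧ (p n : ℝ) ≤ 1 / 2) :
    (∀ n, Integrable (fun ω => largestEigenvalue (A n ω)) (P n)) ∧
    TendstoInDistribution
      (fun (n : ℕ) (ω : Ω n) =>
        (1 / Real.sqrt ((p n : ℝ) * (1 - (p n : ℝ)))) *
          (largestEigenvalue (A n ω) - ∫ ω', largestEigenvalue (A n ω') ∂(P n)))
      atTop (id : ℝ → ℝ) P (gaussianReal 0 2) := by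
  have hint : ∀ n, Integrable (fun ω => largestEigenvalue (A n ω)) (P n) :=
    fun n => (hA n).integrable_comp largestEigenvalue
  have hmeas : ∀ n, AEMeasurable (fun ω => (1 / Real.sqrt ((p n : ℝ) * (1 - (p n : ℝ)))) *
      (largestEigenvalue (A n ω) - ∫ ω', largestEigenvalue (A n ω') ∂(P n))) (P n) :=
    fun n => ((hint n).aemeasurable.sub_const _).const_mul _
  refine ⟨hint, hmeas, aemeasurable_id, ?_⟩
  refine ProbabilityMeasure.tendsto_iff_tendsto_charFun.2 fun t => ?_
  have hlim := tendsto_charFun_largestEigenvalue hε₀.1 (fun n => (p n).2.1) hp t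
  have hgauss : charFun ((gaussianReal 0 2).map (id : ℝ → ℝ)) t
      = Complex.exp ((-t ^ 2 : ℝ) : ℂ) := by
    rw [Measure.map_id, charFun_gaussianReal]
    congr 1
    push_cast
    simp
  simp only [ProbabilityMeasure.coe_mk]
  rw [hgauss]
  refine hlim.congr fun n => ?_
  have hmean : ∫ ω', largestEigenvalue (A n ω') ∂(P n)
      = cubeExp (p n : ℝ) (fun x : Edge n → Bool => largestEigenvalue (adjMat x)) :=
    (hA n).integral_comp largestEigenvalue
  rw [charFun_apply_real, integral_map (hmeas n) (by fun_prop), hmean]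
  refine Eq.trans ?_ ((hA n).integral_comp (fun M => Complex.exp ((t : ℂ) *
    ((1 / Real.sqrt ((p n : ℝ) * (1 - (p n : ℝ))) * (largestEigenvalue M
      - cubeExp (p n : ℝ) (fun x : Edge n → Bool => largestEigenvalue (adjMat x))) : ℝ) : ℂ)
        * Complex.I))).symm
  refine Fintype.sum_congr _ _ fun x => ?_
  rw [Complex.real_smul]
  congr 3
  push_cast
  ring
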